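/- Let $\mathcal H$ be a separable infinite-dimensional Hilbert space over $\mathbb K=\mathbb R$ or $\mathbb C$ with a fixed orthonormal basis $(e_i)_{i\in I}$. Call $x\in B(\mathcal H)$ diagonal if $\langle x e_j,e_i\rangle=0$ for all $i\neq j$, and let $E$ be the diagonal conditional expectation on $B(\mathcal H)$, which replaces all off-diagonal entries of the matrix of an operator by $0$ and keeps the diagonal. "Projection" means orthogonal (self-adjoint) projection. An operator $x\in B(\mathcal H)$ with $\|x\|=1$ is called $2$-pavable if there is a diagonal projection $e$ such that $\|exe\|<1$ and $\|e^{\perp}xe^{\perp}\|<1$, where $e^\perp=\mathrm{id}-e$. Theorem. Let $p,q\in B(\mathcal H)$ be projections such that $E(p)=E(q)=\tfrac12\mathrm{id}$ and such that $2p-\mathrm{id}$ and $2q-\mathrm{id}$ are $2$-pavable. Then there is an operator-norm continuous path $[0,1]\to B(\mathcal H)$ from $p$ to $q$, all of whose values are projections $r$ with $E(r)=\tfrac12\mathrm{id}$. -/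

import Mathlib

namespace DiagProj

variable {𝕜 H ι : Type*} [RCLike 𝕜] [NormedAddCommGroup H] [InnerProductSpace 𝕜 H]

/-- The `i`-th diagonal entry `⟪b i, x (b i)⟫` of the matrix of `x` in the orthonormal basis `b`. -/
noncomputable def diagEntry (b : HilbertBasis ι 𝕜 H) (x : H →L[𝕜] H) (i : ι) : 𝕜 :=
  inner 𝕜 (b i) (x (b i))

/-- An operator is diagonal in the basis `b` if all its off-diagonal matrix entries vanish. -/
def IsDiagonal (b : HilbertBasis ι 𝕜 H) (x : H →L[𝕜] H) : Prop :=
  ∀ i j, i ≠ j → inner 𝕜 (b i) (x (b j)) = 0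

theorem norm_diagEntry_le (b : HilbertBasis ι 𝕜 H) (x : H →L[𝕜] H) (i : ι) :
    ‖diagEntry b x i‖ ≤ ‖x‖ := by
  have h1 : ‖b i‖ = 1 := b.orthonormal.1 i
  calc ‖diagEntry b x i‖ ≤ ‖b i‖ * ‖x (b i)‖ := norm_inner_le_norm _ _
    _ ≤ ‖x‖ := by simpa [h1] using x.le_opNorm (b i)

theorem memlp_diag (b : HilbertBasis ι 𝕜 H) (x : H →L[𝕜] H) (v : lp (fun _ : ι => 𝕜) 2) :
    Memℓp (fun i => diagEntry b x i * v i) 2 := by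
  have h : Memℓp (((‖x‖ : ℝ) : 𝕜) • (v : ι → 𝕜)) 2 := (lp.memℓp v).const_smul _
  refine memℓp_gen (((memℓp_gen_iff (by norm_num)).1 h).of_nonneg_of_le
    (fun i => by positivity) fun i => ?_)
  refine Real.rpow_le_rpow (norm_nonneg _) ?_ (by norm_num)
  rw [Pi.smul_apply, norm_smul, norm_mul, RCLike.norm_ofReal, abs_norm]
  exact mul_le_mul_of_nonneg_right (norm_diagEntry_le b x i) (norm_nonneg (v i))

/-- Entrywise multiplication on `ℓ²` by the sequence of diagonal entries of `x`. -/
noncomputable def diagMul (b : HilbertBasis ι 𝕜 H) (x : H →L[𝕜] H) :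
    lp (fun _ : ι => 𝕜) 2 →L[𝕜] lp (fun _ : ι => 𝕜) 2 :=
  LinearMap.mkContinuous
    { toFun := fun v => ⟨fun i => diagEntry b x i * v i, memlp_diag b x v⟩
      map_add' := fun v w => by ext i; exact mul_add _ _ _
      map_smul' := fun c v => by ext i; exact mul_left_comm _ _ _ }
    ‖x‖ (fun v => by
      have h : ‖(⟨fun i => diagEntry b x i * v i, memlp_diag b x v⟩ :
          lp (fun _ : ι => 𝕜) 2)‖ ≤ ‖((‖x‖ : ℝ) : 𝕜) • v‖ := by
        refine lp.norm_mono (by norm_num) ?_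
        intro i
        rw [lp.coeFn_smul, Pi.smul_apply, norm_smul, RCLike.norm_ofReal, abs_norm, norm_mul]
        exact mul_le_mul_of_nonneg_right (norm_diagEntry_le b x i) (norm_nonneg (v i))
      simpa [norm_smul] using h)

/-- The diagonal conditional expectation `E`: the operator `E x` has the same diagonal as `x`
in the basis `b`, and its off-diagonal entries are zero. -/
noncomputable def diagExp (b : HilbertBasis ι 𝕜 H) (x : H →L[𝕜] H) : H →L[𝕜] H :=
  (b.repr.symm.toContinuousLinearEquiv : lp (fun _ : ι => 𝕜) 2 →L[𝕜] H) ∘L diagMul b x ∘L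
    (b.repr.toContinuousLinearEquiv : H →L[𝕜] lp (fun _ : ι => 𝕜) 2)

theorem inner_diagExp [DecidableEq ι] (b : HilbertBasis ι 𝕜 H) (x : H →L[𝕜] H) (i j : ι) :
    inner 𝕜 (b i) (diagExp b x (b j)) = if i = j then inner 𝕜 (b i) (x (b j)) else 0 := by
  have : inner 𝕜 (b i) (diagExp b x (b j)) = diagEntry b x i * (b.repr (b j)) i := by
    rw [← b.repr_apply_apply]
    simp [diagExp, diagMul]
  rw [this, b.repr_apply_apply, orthonormal_iff_ite.1 b.orthonormal i j]
  split_ifs with h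
  · subst h; simp [diagEntry]
  · simp

variable [CompleteSpace H]

/-- The operator `x` of norm one is 2-pavable with respect to `b` if there is a diagonal
projection `e` with `‖e x e‖ < 1` and `‖e^⊥ x e^⊥‖ < 1`. -/
def IsTwoPavable (b : HilbertBasis ι 𝕜 H) (x : H →L[𝕜] H) : Prop :=
  ‖x‖ = 1 ∧ ∃ e : H →L[𝕜] H, IsStarProjection e ∧ IsDiagonal b e ∧
    ‖e * x * e‖ < 1 ∧ ‖(1 - e) * x * (1 - e)‖ < 1

/-- The set of all (orthogonal) projections `p` with `E(p) = id/2`. -/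
def halfProjections (b : HilbertBasis ι 𝕜 H) : Set (H →L[𝕜] H) :=
  {p | IsStarProjection p ∧ diagExp b p = (1 / 2 : 𝕜) • (1 : H →L[𝕜] H)}

end DiagProj

/-! Under `p ↦ 2p - 1` the problem concerns self-adjoint unitaries with zero diagonal
(`zeroDiagSymmetries`). Let `x` be one and let `e` be a paving projection. Write `x = a + c` with
`a` block-diagonal and `c` off-diagonal relative to `e`. Then `x² = 1` says that `a` and `c`
anticommute and `a² + c² = 1`. Paving means `‖a‖ < 1`, so `1 - a²` is invertible and `c = v √(1 -
a²)` with `v` an off-diagonal symmetry. The path `t a + v √(1 - t² a²)` consists of symmetries and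
joins `v` to `x`. Its diagonal is `t` times that of `x`, hence zero
(`exists_path_to_offDiagSymmetries`).

It remains to join off-diagonal symmetries. For fixed `e`, any two are conjugate by a unitary that
acts only on the range of `e`. That range is infinite-dimensional, so its unitary group is path
connected and they are joined (`joinedIn_offDiagSymmetries`). For two paving sets `A` and `B` of
basis indices, choose `C` meeting `A`, `B` and their complements in infinite sets, with `Cᶜ` doing
the same. A basis permutation that exchanges both `A` with `Aᶜ` and `C` with `Cᶜ` is off-diagonal
for both projections, and likewise for `B` and `C`. So the three families form a connected chain.

Connectedness of the unitary group (`unitary_mem_identityPathComponent`) must cover real scalars,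
where a unitary need not have a skew-adjoint logarithm. Rotations first make the unitary fix
infinitely many orthogonal copies of the space, and an Eilenberg swindle then absorbs the rest. -/

namespace DiagProj

/-! ### Rotations generated by a partial complex structure -/

section Rotation

variable {𝕜 H : Type*} [RCLike 𝕜] [NormedAddCommGroup H] [InnerProductSpace 𝕜 H]

/-- The rotation `exp (t J) = 1 + sin t J + (1 - cos t) J²` generated by a skew-adjoint `J`
with `J³ = -J`. -/
noncomputable def rotationOp (J : H →L[𝕜] H) (t : ℝ) : H →L[𝕜] H :=
  1 + ((Real.sin t : ℝ) : 𝕜) • J + (1 - ((Real.cos t : ℝ) : 𝕜)) • (J * J)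

theorem rotationOp_neg_mul {J : H →L[𝕜] H} (hJ : J * J * J = -J) (t : ℝ) :
    rotationOp J (-t) * rotationOp J t = 1 := by
  have h1 : J * (J * J) = -J := by rw [← mul_assoc, hJ]
  have h2 : (J * J) * (J * J) = -(J * J) := by rw [← mul_assoc, hJ, neg_mul]
  have h3 : ((Real.sin t : ℝ) : 𝕜) ^ 2 = 1 - ((Real.cos t : ℝ) : 𝕜) ^ 2 := by
    rw [← RCLike.ofReal_pow, Real.sin_sq]; push_cast; ring
  have : rotationOp J (-t) * rotationOp J t =
      1 + ((1 - ((Real.cos t : ℝ) : 𝕜) ^ 2) - ((Real.sin t : ℝ) : 𝕜) ^ 2) • (J * J) := by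
    simp only [rotationOp, Real.sin_neg, Real.cos_neg, mul_add, add_mul, one_mul, mul_one,
      smul_mul_assoc, mul_smul_comm, h1, h2, hJ, RCLike.ofReal_neg]
    module
  rw [this, h3]; simp

end Rotation

/-! ### Extending unitaries along isometries, modulo the path component of the identity -/

section Unitaries

variable {𝕜 F G H : Type*} [RCLike 𝕜]
  [NormedAddCommGroup F] [InnerProductSpace 𝕜 F] [CompleteSpace F]
  [NormedAddCommGroup G] [InnerProductSpace 𝕜 G] [CompleteSpace G]
  [NormedAddCommGroup H] [InnerProductSpace 𝕜 H] [CompleteSpace H]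

open ContinuousLinearMap (adjoint)

/-- The adjoint of a linear isometry, as a continuous linear map. -/
noncomputable def coisometry (V : F →ₗᵢ[𝕜] H) : H →L[𝕜] F := adjoint V.toContinuousLinearMap

theorem inner_coisometry_left (V : F →ₗᵢ[𝕜] H) (x : H) (y : F) :
    inner 𝕜 (coisometry V x) y = inner 𝕜 x (V y) :=
  ContinuousLinearMap.adjoint_inner_left _ _ _

theorem inner_coisometry_right (V : F →ₗᵢ[𝕜] H) (x : F) (y : H) :
    inner 𝕜 x (coisometry V y) = inner 𝕜 (V x) y :=
  ContinuousLinearMap.adjoint_inner_right _ _ _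

@[simp]
theorem coisometry_apply (V : F →ₗᵢ[𝕜] H) (x : F) : coisometry V (V x) = x :=
  ext_inner_right 𝕜 fun y => by rw [inner_coisometry_left, V.inner_map_map]

theorem coisometry_apply_eq_zero {V : F →ₗᵢ[𝕜] H} {y : H} (h : ∀ x, inner 𝕜 (V x) y = 0) :
    coisometry V y = 0 :=
  ext_inner_left 𝕜 fun x => by rw [inner_coisometry_right, h, inner_zero_right]

theorem coisometry_comp (V : G →ₗᵢ[𝕜] H) (W : F →ₗᵢ[𝕜] G) (y : H) :
    coisometry (V.comp W) y = coisometry W (coisometry V y) :=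
  ext_inner_left 𝕜 fun x => by simp [inner_coisometry_right]

/-- The operator `V w V* + (1 - V V*)`. -/
noncomputable def extendOp (V : F →ₗᵢ[𝕜] H) (w : F →L[𝕜] F) : H →L[𝕜] H :=
  V.toContinuousLinearMap ∘L w ∘L coisometry V +
    (1 - V.toContinuousLinearMap ∘L coisometry V)

theorem extendOp_apply (V : F →ₗᵢ[𝕜] H) (w : F →L[𝕜] F) (y : H) :
    extendOp V w y = V (w (coisometry V y)) + (y - V (coisometry V y)) := by
  simp [extendOp]

@[simp]
theorem extendOp_one (V : F →ₗᵢ[𝕜] H) : extendOp V 1 = 1 := by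
  ext y; simp [extendOp_apply]

theorem extendOp_mul (V : F →ₗᵢ[𝕜] H) (w w' : F →L[𝕜] F) :
    extendOp V (w * w') = extendOp V w * extendOp V w' := by
  ext y; simp [extendOp_apply]

theorem star_extendOp (V : F →ₗᵢ[𝕜] H) (w : F →L[𝕜] F) :
    star (extendOp V w) = extendOp V (star w) := by
  refine ContinuousLinearMap.ext fun y => ext_inner_right 𝕜 fun z => ?_
  rw [ContinuousLinearMap.star_eq_adjoint, ContinuousLinearMap.star_eq_adjoint,
    ContinuousLinearMap.adjoint_inner_left, extendOp_apply, extendOp_apply]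
  simp only [inner_add_left, inner_add_right, inner_sub_left, inner_sub_right,
    ← inner_coisometry_left, ← inner_coisometry_right, ContinuousLinearMap.adjoint_inner_left]

theorem continuous_extendOp (V : F →ₗᵢ[𝕜] H) : Continuous (extendOp V) := by
  unfold extendOp; fun_prop

/-- The extension of a unitary along a linear isometry, by the identity on the orthogonal
complement of the range. -/
noncomputable def extendUnitary (V : F →ₗᵢ[𝕜] H) :
    unitary (F →L[𝕜] F) →* unitary (H →L[𝕜] H) where
  toFun w := ⟨extendOp V w, by
    rw [Unitary.mem_iff, star_extendOp, ← extendOp_mul, ← extendOp_mul]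
    simp⟩
  map_one' := Subtype.ext (extendOp_one V)
  map_mul' w w' := Subtype.ext (extendOp_mul V _ _)

theorem coe_extendUnitary (V : F →ₗᵢ[𝕜] H) (w : unitary (F →L[𝕜] F)) :
    (extendUnitary V w : H →L[𝕜] H) = extendOp V w := rfl

theorem continuous_extendUnitary (V : F →ₗᵢ[𝕜] H) : Continuous (extendUnitary V) :=
  ((continuous_extendOp V).comp continuous_subtype_val).subtype_mk _

theorem extendUnitary_comp (V : G →ₗᵢ[𝕜] H) (W : F →ₗᵢ[𝕜] G) (w : unitary (F →L[𝕜] F)) :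
    extendUnitary (V.comp W) w = extendUnitary V (extendUnitary W w) := by
  refine Subtype.ext (ContinuousLinearMap.ext fun y => ?_)
  simp [coe_extendUnitary, extendOp_apply, coisometry_comp]
  abel

variable (𝕜 H) in
/-- The path component of the identity in the unitary group, as a subgroup. -/
def identityPathComponent : Subgroup (unitary (H →L[𝕜] H)) where
  carrier := pathComponent 1
  one_mem' := Joined.refl 1
  mul_mem' {u v} hu hv := by
    have := Joined.mul (mem_pathComponent_iff.1 hu) (mem_pathComponent_iff.1 hv)
    rwa [one_mul] at this
  inv_mem' {u} hu := by
    have := Joined.inv (mem_pathComponent_iff.1 hu)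
    rwa [inv_one] at this

theorem mem_identityPathComponent {u : unitary (H →L[𝕜] H)} :
    u ∈ identityPathComponent 𝕜 H ↔ Joined 1 u := Iff.rfl

instance : (identityPathComponent 𝕜 H).Normal where
  conj_mem u hu g := by
    have := (mem_identityPathComponent.1 hu).map (f := fun v => g * v * g⁻¹) (by fun_prop)
    simpa [mem_identityPathComponent] using this

theorem star_rotationOp {J : H →L[𝕜] H} (hJ : star J = -J) (t : ℝ) :
    star (rotationOp J t) = rotationOp J (-t) := by
  simp [rotationOp, hJ]

theorem rotationOp_mem {J : H →L[𝕜] H} (hs : star J = -J) (hJ : J * J * J = -J) (t : ℝ) :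
    rotationOp J t ∈ unitary (H →L[𝕜] H) := by
  rw [Unitary.mem_iff, star_rotationOp hs]
  exact ⟨rotationOp_neg_mul hJ t, by simpa using rotationOp_neg_mul hJ (-t)⟩

theorem rotationOp_mem_identityPathComponent {J : H →L[𝕜] H} (hs : star J = -J)
    (hJ : J * J * J = -J) (t : ℝ) :
    (⟨rotationOp J t, rotationOp_mem hs hJ t⟩ : unitary (H →L[𝕜] H)) ∈
      identityPathComponent 𝕜 H := by
  have hc : Continuous fun s : ℝ =>
      (⟨rotationOp J s, rotationOp_mem hs hJ s⟩ : unitary (H →L[𝕜] H)) := by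
    refine Continuous.subtype_mk ?_ _
    unfold rotationOp
    have h1 : Continuous fun s : ℝ => ((Real.sin s : ℝ) : 𝕜) :=
      RCLike.continuous_ofReal.comp Real.continuous_sin
    have h2 : Continuous fun s : ℝ => ((Real.cos s : ℝ) : 𝕜) :=
      RCLike.continuous_ofReal.comp Real.continuous_cos
    fun_prop
  have h := (PathConnectedSpace.joined (0 : ℝ) t).map hc
  have h0 : (⟨rotationOp J 0, rotationOp_mem hs hJ 0⟩ : unitary (H →L[𝕜] H)) = 1 :=
    Subtype.ext (by simp [rotationOp])
  rwa [h0] at h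

/-- Two linear isometries with orthogonal ranges are related by a unitary in the path component
of the identity. -/
theorem exists_rotation (V W : F →ₗᵢ[𝕜] H) (h : ∀ x y, inner 𝕜 (V x) (W y) = 0) :
    ∃ R ∈ identityPathComponent 𝕜 H, ∀ x, (R : H →L[𝕜] H) (V x) = W x := by
  have hVW : ∀ x, coisometry V (W x) = 0 := fun x => coisometry_apply_eq_zero fun y => h y x
  have hWV : ∀ x, coisometry W (V x) = 0 := fun x => coisometry_apply_eq_zero fun y => by
    rw [inner_eq_zero_symm, h]
  let J : H →L[𝕜] H := W.toContinuousLinearMap ∘L coisometry V -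
    V.toContinuousLinearMap ∘L coisometry W
  have hJa : ∀ y, J y = W (coisometry V y) - V (coisometry W y) := fun y => rfl
  have hs : star J = -J := by
    refine ContinuousLinearMap.ext fun y => ext_inner_right 𝕜 fun z => ?_
    rw [ContinuousLinearMap.star_eq_adjoint, ContinuousLinearMap.adjoint_inner_left,
      neg_apply, hJa, hJa, neg_sub]
    simp only [inner_sub_left, inner_sub_right, ← inner_coisometry_left, ← inner_coisometry_right]
  have hJ : J * J * J = -J := by
    ext y
    simp [hJa, hVW, hWV]
    abel
  -- At angle `π / 2` the rotation is `1 + J + J²`, and `J V = W`, `J² V = -V`.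
  refine ⟨_, rotationOp_mem_identityPathComponent hs hJ (Real.pi / 2), fun x => ?_⟩
  simp [rotationOp, hJa, hVW, hWV]

theorem extendUnitary_conj {V W : F →ₗᵢ[𝕜] H} {R : unitary (H →L[𝕜] H)}
    (hR : ∀ x, (R : H →L[𝕜] H) (V x) = W x) (w : unitary (F →L[𝕜] F)) :
    R * extendUnitary V w * R⁻¹ = extendUnitary W w := by
  rw [mul_inv_eq_iff_eq_mul]
  refine Subtype.ext (ContinuousLinearMap.ext fun y => ?_)
  have hR' : ∀ y, coisometry W ((R : H →L[𝕜] H) y) = coisometry V y := fun y =>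
    ext_inner_left 𝕜 fun x => by
      rw [inner_coisometry_right, inner_coisometry_right, ← hR]
      exact (Unitary.linearIsometryEquiv R).inner_map_map _ _
  simp [coe_extendUnitary, extendOp_apply, hR, hR']

/-- The quotient is a commutator of a rotation carrying `W` to `V` with an extended unitary. The
rotation lies in a normal subgroup, hence so does the commutator. -/
theorem extendUnitary_div_mem (V W : F →ₗᵢ[𝕜] H) (h : ∀ x y, inner 𝕜 (V x) (W y) = 0)
    (w : unitary (F →L[𝕜] F)) :
    extendUnitary V w / extendUnitary W w ∈ identityPathComponent 𝕜 H := by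
  obtain ⟨R, hR, hRV⟩ := exists_rotation W V fun x y => by rw [inner_eq_zero_symm, h]
  rw [← extendUnitary_conj hRV, div_eq_mul_inv, mul_assoc, mul_assoc]
  refine mul_mem hR ?_
  rw [← mul_assoc]
  exact Subgroup.Normal.conj_mem inferInstance _ (inv_mem hR) _

end Unitaries

end DiagProj

namespace DiagProj

/-! ### The Eilenberg swindle on `ℓ²(ℕ, H)` -/

section Swindle

variable {𝕜 H : Type*} [RCLike 𝕜]
  [NormedAddCommGroup H] [InnerProductSpace 𝕜 H]

variable (𝕜 H) in
/-- The inclusion of the `n`-th summand of `ℓ²(ℕ, H)`. -/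
noncomputable def singleIsometry (n : ℕ) : H →ₗᵢ[𝕜] lp (fun _ : ℕ => H) 2 where
  toLinearMap := lp.lsingle (E := fun _ : ℕ => H) 2 n
  norm_map' x := lp.norm_single (E := fun _ : ℕ => H) (p := 2) (by norm_num) n x

theorem singleIsometry_apply (n : ℕ) (x : H) :
    singleIsometry 𝕜 H n x = lp.single (E := fun _ : ℕ => H) 2 n x := rfl

theorem orthogonalFamily_singleIsometry :
    OrthogonalFamily 𝕜 (fun _ : ℕ => H) (singleIsometry 𝕜 H) := by
  intro i j hij x y
  rw [singleIsometry_apply, singleIsometry_apply, lp.inner_single_left,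
    lp.single_apply_ne _ _ _ hij, inner_zero_right]

theorem OrthogonalFamily.comp_isometry {E : ℕ → Type*} {G : ℕ → Type*} {K : Type*}
    [∀ n, NormedAddCommGroup (E n)] [∀ n, InnerProductSpace 𝕜 (E n)]
    [∀ n, NormedAddCommGroup (G n)] [∀ n, InnerProductSpace 𝕜 (G n)]
    [NormedAddCommGroup K] [InnerProductSpace 𝕜 K] {V : ∀ n, G n →ₗᵢ[𝕜] K}
    (hV : OrthogonalFamily 𝕜 G V) (w : ∀ n, E n →ₗᵢ[𝕜] G n) :
    OrthogonalFamily 𝕜 E fun n => (V n).comp (w n) :=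
  fun _ _ hij _ _ => hV hij _ _

theorem ext_singleIsometry {K : Type*} [NormedAddCommGroup K] [NormedSpace 𝕜 K]
    {f g : lp (fun _ : ℕ => H) 2 →L[𝕜] K}
    (h : ∀ n x, f (singleIsometry 𝕜 H n x) = g (singleIsometry 𝕜 H n x)) : f = g := by
  refine ContinuousLinearMap.ext fun x => ?_
  have hx := lp.hasSum_single (p := 2) (by norm_num) x
  refine (hx.mapL f).unique ?_
  have hfg : (fun n => f (lp.single 2 n (x n))) = fun n => g (lp.single 2 n (x n)) :=
    funext fun n => h n (x n)
  exact hfg ▸ hx.mapL g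

variable [CompleteSpace H]

/-- The linear isometry `w ⊕ w ⊕ ⋯` of `ℓ²(ℕ, H)`. -/
noncomputable def ampliationIsometry (w : H →ₗᵢ[𝕜] H) :
    lp (fun _ : ℕ => H) 2 →ₗᵢ[𝕜] lp (fun _ : ℕ => H) 2 :=
  (OrthogonalFamily.comp_isometry orthogonalFamily_singleIsometry fun _ => w).linearIsometry

theorem ampliationIsometry_single (w : H →ₗᵢ[𝕜] H) (n : ℕ) (x : H) :
    ampliationIsometry w (singleIsometry 𝕜 H n x) = singleIsometry 𝕜 H n (w x) := by
  rw [ampliationIsometry, singleIsometry_apply, OrthogonalFamily.linearIsometry_apply_single]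
  rfl

/-- The unitary `w ⊕ w ⊕ ⋯` of `ℓ²(ℕ, H)`. -/
noncomputable def ampliation (w : unitary (H →L[𝕜] H)) :
    unitary (lp (fun _ : ℕ => H) 2 →L[𝕜] lp (fun _ : ℕ => H) 2) :=
  Unitary.linearIsometryEquiv.symm
    { (ampliationIsometry (Unitary.linearIsometryEquiv w).toLinearIsometry) with
      invFun := ampliationIsometry (Unitary.linearIsometryEquiv w).symm.toLinearIsometry
      left_inv := fun x => by
        have : (ampliationIsometry
            (Unitary.linearIsometryEquiv w).symm.toLinearIsometry).toContinuousLinearMap ∘L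
            (ampliationIsometry
            (Unitary.linearIsometryEquiv w).toLinearIsometry).toContinuousLinearMap = 1 :=
          ext_singleIsometry fun n x => by simp [ampliationIsometry_single]
        exact DFunLike.congr_fun this x
      right_inv := fun x => by
        have : (ampliationIsometry
            (Unitary.linearIsometryEquiv w).toLinearIsometry).toContinuousLinearMap ∘L
            (ampliationIsometry
            (Unitary.linearIsometryEquiv w).symm.toLinearIsometry).toContinuousLinearMap = 1 :=
          ext_singleIsometry fun n x => by simp [ampliationIsometry_single]
        exact DFunLike.congr_fun this x }

theorem ampliation_single (w : unitary (H →L[𝕜] H)) (n : ℕ) (x : H) :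
    (ampliation w : lp (fun _ : ℕ => H) 2 →L[𝕜] _) (singleIsometry 𝕜 H n x) =
      singleIsometry 𝕜 H n ((w : H →L[𝕜] H) x) :=
  ampliationIsometry_single _ n x

variable (𝕜 H) in
/-- The unilateral shift of `ℓ²(ℕ, H)`. -/
noncomputable def shiftIsometry : lp (fun _ : ℕ => H) 2 →ₗᵢ[𝕜] lp (fun _ : ℕ => H) 2 :=
  ((orthogonalFamily_singleIsometry (𝕜 := 𝕜) (H := H)).comp
    (f := Nat.succ) Nat.succ_injective).linearIsometry

theorem shiftIsometry_single (n : ℕ) (x : H) :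
    shiftIsometry 𝕜 H (singleIsometry 𝕜 H n x) = singleIsometry 𝕜 H (n + 1) x := by
  rw [shiftIsometry, singleIsometry_apply, OrthogonalFamily.linearIsometry_apply_single]

theorem coisometry_shiftIsometry_single_zero (x : H) :
    coisometry (shiftIsometry 𝕜 H) (singleIsometry 𝕜 H 0 x) = 0 := by
  refine coisometry_apply_eq_zero fun y => ?_
  have h : (innerSL 𝕜 (singleIsometry 𝕜 H 0 x : lp (fun _ : ℕ => H) 2)) ∘L
      (shiftIsometry 𝕜 H).toContinuousLinearMap = 0 := by
    refine ext_singleIsometry fun n z => ?_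
    simpa [shiftIsometry_single] using
      orthogonalFamily_singleIsometry (Nat.succ_ne_zero n).symm x z
  rw [inner_eq_zero_symm]
  exact DFunLike.congr_fun h y

theorem coisometry_singleIsometry_succ (n : ℕ) (x : H) :
    coisometry (singleIsometry 𝕜 H 0) (singleIsometry 𝕜 H (n + 1) x) = 0 :=
  coisometry_apply_eq_zero fun y =>
    orthogonalFamily_singleIsometry (Nat.succ_ne_zero n).symm y x

/-- This is `w ⊕ w ⊕ ⋯ = (w ⊕ 1 ⊕ 1 ⊕ ⋯)(1 ⊕ w ⊕ w ⊕ ⋯)`, checked summand by summand. -/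
theorem ampliation_eq_mul (w : unitary (H →L[𝕜] H)) :
    ampliation w = extendUnitary (singleIsometry 𝕜 H 0) w *
      extendUnitary (shiftIsometry 𝕜 H) (ampliation w) := by
  refine Subtype.ext (ext_singleIsometry fun n x => ?_)
  rw [ampliation_single, Submonoid.coe_mul, coe_extendUnitary, coe_extendUnitary,
    mul_apply_eq_comp]
  cases n with
  | zero =>
    rw [extendOp_apply (shiftIsometry 𝕜 H), coisometry_shiftIsometry_single_zero, map_zero,
      map_zero, sub_zero, zero_add, extendOp_apply, coisometry_apply, sub_self, add_zero]
  | succ n =>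
    rw [← shiftIsometry_single, ← shiftIsometry_single,
      extendOp_apply (shiftIsometry 𝕜 H), coisometry_apply, sub_self, add_zero, ampliation_single,
      shiftIsometry_single, extendOp_apply, coisometry_singleIsometry_succ]
    simp

/-- **Swindle**: if `H` embeds into `K` infinitely often with orthogonal ranges, then unitaries
extended from the first copy lie in the path component of the identity. -/
theorem extendUnitary_mem_of_orthogonalFamily {K : Type*} [NormedAddCommGroup K]
    [InnerProductSpace 𝕜 K] [CompleteSpace K] {V : ℕ → H →ₗᵢ[𝕜] K}
    (hV : OrthogonalFamily 𝕜 (fun _ : ℕ => H) V) (w : unitary (H →L[𝕜] H)) :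
    extendUnitary (V 0) w ∈ identityPathComponent 𝕜 K := by
  have hev := hV.comp (f := fun n => 2 * n) (mul_right_injective₀ two_ne_zero)
  have hodd := hV.comp (f := fun n => 2 * n + 1) fun m n h => by simpa using h
  set i := hev.linearIsometry with hi
  set j := hodd.linearIsometry with hj
  have hij : ∀ x y, inner 𝕜 (i x) (j y) = 0 := by
    intro x y
    have h1 : ∀ m (z : H), (innerSL 𝕜 (V (2 * m) z)) ∘L j.toContinuousLinearMap = 0 := by
      refine fun m z => ext_singleIsometry fun n t => ?_
      simp only [ContinuousLinearMap.comp_apply, LinearIsometry.coe_toContinuousLinearMap,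
        singleIsometry_apply, hj,
        OrthogonalFamily.linearIsometry_apply_single, innerSL_apply_apply]
      exact hV (by omega) z t
    have h2 : (innerSL 𝕜 (j y)) ∘L i.toContinuousLinearMap = 0 := by
      refine ext_singleIsometry fun n t => ?_
      simp only [ContinuousLinearMap.comp_apply, LinearIsometry.coe_toContinuousLinearMap,
        singleIsometry_apply, hi,
        OrthogonalFamily.linearIsometry_apply_single, innerSL_apply_apply]
      exact inner_eq_zero_symm.1 (DFunLike.congr_fun (h1 n t) y)
    rw [inner_eq_zero_symm]
    exact DFunLike.congr_fun h2 x
  have h0 : V 0 = i.comp (singleIsometry 𝕜 H 0) := by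
    ext x
    simp [hi, singleIsometry_apply]
  -- The odd copies `j` are orthogonal to both `i` and `i ∘ shift`. Comparing each with `j` and
  -- dividing leaves the extension along `i` of `w ⊕ w ⊕ ⋯` over `1 ⊕ w ⊕ ⋯`, that is, `w` in the
  -- copy `V 0`.
  have h1 := extendUnitary_div_mem i j hij (ampliation w)
  have h2 := extendUnitary_div_mem (i.comp (shiftIsometry 𝕜 H)) j (fun x y => hij _ y)
    (ampliation w)
  have h3 := div_mem h1 h2
  rw [div_div_div_cancel_right, extendUnitary_comp, ← map_div] at h3
  rw [h0, extendUnitary_comp]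
  rwa [div_eq_iff_eq_mul.2 (ampliation_eq_mul w)] at h3

end Swindle

end DiagProj

namespace DiagProj

/-! ### Path connectedness of the unitary group -/

section Connected

variable {𝕜 H K ι : Type*} [RCLike 𝕜]
  [NormedAddCommGroup H] [InnerProductSpace 𝕜 H]
  [NormedAddCommGroup K] [InnerProductSpace 𝕜 K]

theorem ext_hilbertBasis (b : HilbertBasis ι 𝕜 H) {f g : H →L[𝕜] K}
    (h : ∀ i, f (b i) = g (b i)) : f = g := by
  refine ContinuousLinearMap.ext_on (Submodule.dense_iff_topologicalClosure_eq_top.2 b.dense_span) ?_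
  rintro _ ⟨i, rfl⟩
  exact h i

theorem inner_map_map_eq_zero (b : HilbertBasis ι 𝕜 H) (V W : H →ₗᵢ[𝕜] K)
    (h : ∀ i j, inner 𝕜 (V (b i)) (W (b j)) = 0) (x y : H) : inner 𝕜 (V x) (W y) = 0 := by
  have h1 : ∀ i, (innerSL 𝕜 (V (b i))) ∘L W.toContinuousLinearMap = 0 := fun i =>
    ext_hilbertBasis b fun j => h i j
  have h2 : (innerSL 𝕜 (W y)) ∘L V.toContinuousLinearMap = 0 :=
    ext_hilbertBasis b fun i => inner_eq_zero_symm.1 (DFunLike.congr_fun (h1 i) y)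
  exact inner_eq_zero_symm.1 (DFunLike.congr_fun h2 x)

variable [CompleteSpace K]

/-- The linear isometry sending a Hilbert basis to an orthonormal family. -/
noncomputable def isometryOfOrthonormal (b : HilbertBasis ι 𝕜 H) {v : ι → K}
    (hv : Orthonormal 𝕜 v) : H →ₗᵢ[𝕜] K :=
  hv.orthogonalFamily.linearIsometry.comp b.repr.toLinearIsometry

theorem isometryOfOrthonormal_apply (b : HilbertBasis ι 𝕜 H) {v : ι → K}
    (hv : Orthonormal 𝕜 v) (i : ι) : isometryOfOrthonormal b hv (b i) = v i := by
  classical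
  simp [isometryOfOrthonormal, b.repr_self]

/-- Greedy choice: each new unit vector avoids the finite-dimensional span of `x`, `u x` and `u* x`
for all earlier `x`. The adjoint takes care of the pairs with `m > n`. -/
theorem exists_orthonormal_seq (hK : ¬ FiniteDimensional 𝕜 K) (u : K →L[𝕜] K) :
    ∃ z : ℕ → K, Orthonormal 𝕜 z ∧ ∀ m n, m ≠ n → inner 𝕜 (u (z m)) (z n) = 0 := by
  have hstep : ∀ s : Finset K, (∀ x ∈ s, ‖x‖ = 1) → ∃ y : K, ‖y‖ = 1 ∧ ∀ x ∈ s,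
      inner 𝕜 x y = 0 ∧ inner 𝕜 (u x) y = 0 ∧
        inner 𝕜 (ContinuousLinearMap.adjoint u x) y = 0 := by
    intro s _
    let T : Set K := s ∪ u '' s ∪ ContinuousLinearMap.adjoint u '' s
    have hT : T.Finite := (s.finite_toSet.union (s.finite_toSet.image _)).union
      (s.finite_toSet.image _)
    have : FiniteDimensional 𝕜 (Submodule.span 𝕜 T) := FiniteDimensional.span_of_finite 𝕜 hT
    have hne : (Submodule.span 𝕜 T)ᗮ ≠ ⊥ := fun h => by
      rw [Submodule.orthogonal_eq_bot_iff] at h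
      rw [h] at this
      exact hK (Module.Finite.equiv (Submodule.topEquiv (R := 𝕜) (M := K)))
    obtain ⟨y, hy, hy0⟩ := Submodule.exists_mem_ne_zero_of_ne_bot hne
    have key : ∀ t ∈ T, inner 𝕜 t (((‖y‖⁻¹ : ℝ) : 𝕜) • y) = 0 := fun t ht => by
      rw [inner_smul_right, (Submodule.mem_orthogonal _ _).1 hy t (Submodule.subset_span ht),
        mul_zero]
    refine ⟨((‖y‖⁻¹ : ℝ) : 𝕜) • y, ?_, fun x hx => ⟨key _ ?_, key _ ?_, key _ ?_⟩⟩
    · rw [norm_smul, RCLike.norm_ofReal, abs_of_nonneg (by positivity),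
        inv_mul_cancel₀ (norm_ne_zero_iff.2 hy0)]
    · exact Or.inl (Or.inl hx)
    · exact Or.inl (Or.inr ⟨x, hx, rfl⟩)
    · exact Or.inr ⟨x, hx, rfl⟩
  obtain ⟨z, hz1, hz⟩ := exists_seq_of_forall_finset_exists _ _ hstep
  refine ⟨z, ⟨hz1, fun m n hmn => ?_⟩, fun m n hmn => ?_⟩
  · rcases lt_or_gt_of_ne hmn with h | h
    · exact (hz m n h).1
    · exact inner_eq_zero_symm.1 (hz n m h).1
  · rcases lt_or_gt_of_ne hmn with h | h
    · exact (hz m n h).2.1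
    · rw [← ContinuousLinearMap.adjoint_inner_right]
      exact inner_eq_zero_symm.1 (hz n m h).2.2

/-- A unitary fixing the orthogonal complement of `M` pointwise is extended from `M`. -/
theorem exists_extendUnitary_eq (M : Submodule 𝕜 K) [CompleteSpace M]
    (u : unitary (K →L[𝕜] K)) (hu : ∀ y ∈ Mᗮ, (u : K →L[𝕜] K) y = y) :
    ∃ w : unitary (M →L[𝕜] M), extendUnitary M.subtypeₗᵢ w = u := by
  set V := M.subtypeₗᵢ
  have hV : ∀ x ∈ M, V (coisometry V x) = x := fun x hx =>
    congrArg V (coisometry_apply V ⟨x, hx⟩)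
  -- Since `v` fixes `Mᗮ` pointwise and preserves inner products, it maps `M` into `M`.
  have hmem : ∀ v : unitary (K →L[𝕜] K), (∀ y ∈ Mᗮ, (v : K →L[𝕜] K) y = y) → ∀ x : M,
      V (coisometry V ((v : K →L[𝕜] K) (V x))) = (v : K →L[𝕜] K) (V x) := fun v hv x => by
    refine hV _ ?_
    refine M.orthogonal_orthogonal.le ((Submodule.mem_orthogonal _ _).2 fun y hy => ?_)
    rw [← hv y hy]
    exact ((Unitary.linearIsometryEquiv v).inner_map_map _ _).trans
      (Submodule.inner_left_of_mem_orthogonal x.2 hy)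
  let c : unitary (K →L[𝕜] K) → (M →L[𝕜] M) := fun v =>
    coisometry V ∘L (v : K →L[𝕜] K) ∘L V.toContinuousLinearMap
  have hc : ∀ v x, c v x = coisometry V ((v : K →L[𝕜] K) (V x)) := fun v x => rfl
  have hstar : star (c u) = c (star u) := by
    refine ContinuousLinearMap.ext fun y => ext_inner_right 𝕜 fun z => ?_
    rw [ContinuousLinearMap.star_eq_adjoint, ContinuousLinearMap.adjoint_inner_left, hc, hc,
      inner_coisometry_left, inner_coisometry_right, Unitary.coe_star,
      ContinuousLinearMap.star_eq_adjoint, ContinuousLinearMap.adjoint_inner_left]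
  have h1 : ∀ x, (star u : K →L[𝕜] K) ((u : K →L[𝕜] K) x) = x := fun x =>
    DFunLike.congr_fun (Unitary.coe_star_mul_self u) x
  have h2 : ∀ x, (u : K →L[𝕜] K) ((star u : K →L[𝕜] K) x) = x := fun x =>
    DFunLike.congr_fun (Unitary.coe_mul_star_self u) x
  have hu' : ∀ y ∈ Mᗮ, ((star u : unitary (K →L[𝕜] K)) : K →L[𝕜] K) y = y := fun y hy => by
    conv_lhs => rw [← hu y hy]
    exact h1 y
  refine ⟨⟨c u, ?_⟩, ?_⟩
  · rw [Unitary.mem_iff, hstar]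
    constructor <;> refine ContinuousLinearMap.ext fun x => ?_
    · rw [mul_apply_eq_comp, hc, hc]
      rw [hmem u hu]
      simp [h1]
    · rw [mul_apply_eq_comp, hc, hc]
      rw [hmem _ hu']
      simp [h2]
  · refine Subtype.ext (ContinuousLinearMap.ext fun y => ?_)
    have hy : y - V (coisometry V y) ∈ Mᗮ := by
      rw [Submodule.mem_orthogonal]
      intro x hx
      have : inner 𝕜 (V ⟨x, hx⟩) (y - V (coisometry V y)) = 0 := by
        rw [← inner_coisometry_right]; simp
      exact this
    rw [coe_extendUnitary, extendOp_apply]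
    change V (c u _) + _ = _
    rw [hc, hmem u hu]
    conv_lhs => rw [← hu _ hy]
    rw [← map_add, add_sub_cancel]

/-- The unitary group of an infinite-dimensional separable Hilbert space is path connected. -/
theorem unitary_mem_identityPathComponent [Countable ι] (b : HilbertBasis ι 𝕜 K)
    (hK : ¬ FiniteDimensional 𝕜 K) (u : unitary (K →L[𝕜] K)) :
    u ∈ identityPathComponent 𝕜 K := by
  obtain ⟨z, hz, hzu⟩ := exists_orthonormal_seq hK (u : K →L[𝕜] K)
  obtain ⟨f, hf⟩ := exists_injective_nat ι
  -- In the index `2 * pair n (f i) + r`, the parity `r` selects one of two orthogonal families, `n`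
  -- numbers the copies of `K` in it, and `i` is the basis vector.
  have hg : ∀ r : ℕ, ∀ {n m : ℕ} {i j : ι},
      2 * Nat.pair n (f i) + r = 2 * Nat.pair m (f j) + r → n = m ∧ i = j := by
    intro r n m i j h
    have h' := Nat.pair_eq_pair.1 (show Nat.pair n (f i) = Nat.pair m (f j) by omega)
    exact ⟨h'.1, hf h'.2⟩
  have hon : ∀ r n : ℕ, Orthonormal 𝕜 fun i => z (2 * Nat.pair n (f i) + r) := fun r n =>
    hz.comp _ fun i j h => (hg r h).2
  let θ : ℕ → ℕ → K →ₗᵢ[𝕜] K := fun r n => isometryOfOrthonormal b (hon r n)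
  have hθb : ∀ r n i, θ r n (b i) = z (2 * Nat.pair n (f i) + r) := fun r n i =>
    isometryOfOrthonormal_apply b _ i
  have hθ : ∀ r, OrthogonalFamily 𝕜 (fun _ : ℕ => K) (θ r) := fun r n m hnm x y =>
    inner_map_map_eq_zero b _ _ (fun i j => by
      rw [hθb, hθb]
      exact hz.2 fun h => hnm (hg r h).1) x y
  let S : ℕ → lp (fun _ : ℕ => K) 2 →ₗᵢ[𝕜] K := fun r => (hθ r).linearIsometry
  have hSθ : ∀ r n x, S r (singleIsometry 𝕜 K n x) = θ r n x := fun r n x =>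
    (hθ r).linearIsometry_apply_single x
  have hS : ∀ V W : lp (fun _ : ℕ => K) 2 →ₗᵢ[𝕜] K,
      (∀ n m i j, inner 𝕜 (V (singleIsometry 𝕜 K n (b i))) (W (singleIsometry 𝕜 K m (b j))) = 0) →
      ∀ x y, inner 𝕜 (V x) (W y) = 0 := by
    intro V W h x y
    have h1 : ∀ n m (s t : K),
        inner 𝕜 (V (singleIsometry 𝕜 K n s)) (W (singleIsometry 𝕜 K m t)) = 0 := fun n m =>
      inner_map_map_eq_zero b (V.comp (singleIsometry 𝕜 K n)) (W.comp (singleIsometry 𝕜 K m))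
        fun i j => h n m i j
    have h2 : ∀ n s, (innerSL 𝕜 (V (singleIsometry 𝕜 K n s))) ∘L W.toContinuousLinearMap = 0 :=
      fun n s => ext_singleIsometry fun m t => h1 n m s t
    have h3 : (innerSL 𝕜 (W y)) ∘L V.toContinuousLinearMap = 0 :=
      ext_singleIsometry fun n s => inner_eq_zero_symm.1 (DFunLike.congr_fun (h2 n s) y)
    exact inner_eq_zero_symm.1 (DFunLike.congr_fun h3 x)
  -- By parity `u ∘ S 0` is orthogonal to `S 1`, and `S 1` to `S 0`. Two rotations thus bring `u ∘ S
  -- 0` back to `S 0`.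
  obtain ⟨R₁, hR₁, hR₁u⟩ := exists_rotation
    ((Unitary.linearIsometryEquiv u).toLinearIsometry.comp (S 0)) (S 1) <| hS _ _ fun n m i j => by
      change inner 𝕜 ((u : K →L[𝕜] K) (S 0 _)) _ = 0
      rw [hSθ, hSθ, hθb, hθb]
      exact hzu _ _ (by omega)
  obtain ⟨R₂, hR₂, hR₂S⟩ := exists_rotation (S 1) (S 0) <| hS _ _ fun n m i j => by
      rw [hSθ, hSθ, hθb, hθb]
      exact hz.2 (by omega)
  set u' := R₂ * R₁ * u with hu'
  have hfix : ∀ x, (u' : K →L[𝕜] K) (S 0 x) = S 0 x := fun x => by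
    refine Eq.trans ?_ ((congrArg _ (hR₁u x)).trans (hR₂S x))
    rfl
  suffices h : u' ∈ identityPathComponent 𝕜 K from
    (Subgroup.mul_mem_cancel_left _ (mul_mem hR₂ hR₁)).1 h
  set M := (LinearMap.range (S 0).toLinearMap)ᗮ
  have hcl : IsClosed (LinearMap.range (S 0).toLinearMap : Set K) := by
    rw [LinearMap.coe_range]
    exact (S 0).isometry.isClosedEmbedding.isClosed_range
  obtain ⟨w, hw⟩ := exists_extendUnitary_eq M u' fun y hy => by
    rw [Submodule.orthogonal_orthogonal_eq_closure, hcl.submodule_topologicalClosure_eq] at hy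
    obtain ⟨x, rfl⟩ := hy
    exact hfix x
  -- The swindle handles `u'` transplanted to the copy `θ 0 0` of `K`. That copy lies in the range
  -- of `S 0`, orthogonal to `M`, so `u'`, which lives on `M`, differs from its transplant by an
  -- element of the component.
  have h1 := extendUnitary_mem_of_orthogonalFamily (hθ 0) u'
  have h2 := extendUnitary_div_mem M.subtypeₗᵢ ((θ 0 0).comp M.subtypeₗᵢ) (fun x y => by
    change inner 𝕜 (x : K) (θ 0 0 (y : K)) = 0
    rw [← hSθ]
    exact Submodule.inner_left_of_mem_orthogonal (LinearMap.mem_range_self _ _) x.2) w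
  rw [extendUnitary_comp, hw] at h2
  simpa using mul_mem h2 h1

end Connected

end DiagProj

namespace DiagProj

/-! ### Square roots from the Catalan generating series -/

section CatalanSeries

variable {A : Type*} [NormedRing A]

/-- The generating series of the Catalan numbers. -/
noncomputable def catalanSeries (z : A) : A := ∑' n, catalan n • z ^ n

/-- This growth bound gives convergence for `‖z‖ < 1 / 4`. -/
theorem catalan_le_four_pow (n : ℕ) : catalan n ≤ 4 ^ n := by
  rw [catalan_eq_centralBinom_div]
  calc n.centralBinom / (n + 1) ≤ n.centralBinom := Nat.div_le_self _ _
    _ ≤ 2 ^ (2 * n) := Nat.choose_le_two_pow _ _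
    _ = 4 ^ n := by rw [pow_mul]; norm_num

theorem norm_catalan_smul_le [NormOneClass A] {z : A} {r : ℝ} (hz : ‖z‖ ≤ r) (n : ℕ) :
    ‖catalan n • z ^ n‖ ≤ (4 * r) ^ n := by
  have h : (catalan n : ℝ) ≤ 4 ^ n := by exact_mod_cast catalan_le_four_pow n
  calc ‖catalan n • z ^ n‖ ≤ catalan n * ‖z ^ n‖ := norm_nsmul_le
    _ ≤ 4 ^ n * r ^ n :=
      mul_le_mul h ((norm_pow_le z n).trans (pow_le_pow_left₀ (norm_nonneg z) hz n))
        (norm_nonneg _) (by positivity)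
    _ = (4 * r) ^ n := (mul_pow _ _ _).symm

theorem summable_norm_catalanSeries [NormOneClass A] {z : A} (hz : ‖z‖ < 1 / 4) :
    Summable fun n => ‖catalan n • z ^ n‖ :=
  Summable.of_nonneg_of_le (fun _ => norm_nonneg _) (norm_catalan_smul_le le_rfl)
    (summable_geometric_of_lt_one (by positivity) (by linarith))

theorem continuousOn_catalanSeries [CompleteSpace A] [NormOneClass A] {r : ℝ} (h0 : 0 ≤ r)
    (hr : r < 1 / 4) : ContinuousOn (catalanSeries (A := A)) (Metric.closedBall 0 r) :=
  continuousOn_tsum (fun n => by fun_prop)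
    (summable_geometric_of_lt_one (r := 4 * r) (by positivity) (by linarith))
    fun n z hz => norm_catalan_smul_le (by simpa using hz) n

/-- The Cauchy product turns the convolution recurrence of the Catalan numbers into this quadratic
equation. -/
theorem catalanSeries_eq [CompleteSpace A] [NormOneClass A] {z : A} (hz : ‖z‖ < 1 / 4) :
    catalanSeries z = 1 + z * (catalanSeries z * catalanSeries z) := by
  have hs := summable_norm_catalanSeries hz
  have hsq : catalanSeries z * catalanSeries z = ∑' n, catalan (n + 1) • z ^ n := by
    rw [catalanSeries, tsum_mul_tsum_eq_tsum_sum_antidiagonal_of_summable_norm hs hs]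
    refine tsum_congr fun n => ?_
    rw [catalan_succ', Finset.sum_smul]
    refine Finset.sum_congr rfl fun kl hkl => ?_
    rw [smul_mul_smul_comm, ← pow_add, Finset.HasAntidiagonal.mem_antidiagonal.1 hkl]
  have hs' : Summable fun n => catalan (n + 1) • z ^ n := by
    have := summable_norm_sum_mul_antidiagonal_of_summable_norm hs hs
    refine this.of_norm.congr fun n => ?_
    rw [catalan_succ', Finset.sum_smul]
    refine (Finset.sum_congr rfl fun kl hkl => ?_).symm
    rw [smul_mul_smul_comm, ← pow_add, Finset.HasAntidiagonal.mem_antidiagonal.1 hkl]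
  rw [hsq, ← hs'.tsum_mul_left, catalanSeries, hs.of_norm.tsum_eq_zero_add]
  congr 1
  · simp
  · exact tsum_congr fun n => by rw [mul_smul_comm, pow_succ']

theorem Commute.catalanSeries_right {y z : A} (h : Commute y z) : Commute y (catalanSeries z) :=
  Commute.tsum_right _ fun n => (h.pow_right n).smul_right _

/-- The square root of `1 - 4 z`. -/
noncomputable def sqrtSeries (z : A) : A := 1 - 2 * (z * catalanSeries z)

theorem Commute.sqrtSeries_right {y z : A} (h : Commute y z) : Commute y (sqrtSeries z) :=
  (Commute.one_right y).sub_right <|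
    (Commute.ofNat_right y 2).mul_right (h.mul_right (Commute.catalanSeries_right h))

/-- With `C = 1 + z C²`, one has `(1 - 2zC)² = 1 - 4zC + 4z(C - 1) = 1 - 4z`. -/
theorem sqrtSeries_mul_self [CompleteSpace A] [NormOneClass A] {z : A} (hz : ‖z‖ < 1 / 4) :
    sqrtSeries z * sqrtSeries z = 1 - 4 * z := by
  have hc : z * catalanSeries z = catalanSeries z * z :=
    Commute.catalanSeries_right (Commute.refl z)
  have h : z * catalanSeries z * (z * catalanSeries z) = z * (catalanSeries z - 1) := by
    conv_rhs => rw [catalanSeries_eq hz]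
    rw [add_sub_cancel_left, mul_assoc, ← mul_assoc _ z, ← hc]
    simp only [mul_assoc]
  have h2 : sqrtSeries z * sqrtSeries z = 1 - 4 * (z * catalanSeries z) +
      4 * (z * catalanSeries z * (z * catalanSeries z)) := by
    unfold sqrtSeries; noncomm_ring
  rw [h2, h]; noncomm_ring

theorem isSelfAdjoint_sqrtSeries [StarRing A] [ContinuousStar A] {z : A} (hz : IsSelfAdjoint z) :
    IsSelfAdjoint (sqrtSeries z) := by
  have h : IsSelfAdjoint (catalanSeries z) := by
    rw [IsSelfAdjoint, catalanSeries, tsum_star]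
    exact tsum_congr fun n => by rw [star_nsmul, star_pow, hz.star_eq]
  have hc : Commute z (catalanSeries z) := Commute.catalanSeries_right (Commute.refl z)
  have h2 : IsSelfAdjoint (2 : A) := by simp [IsSelfAdjoint]
  refine (IsSelfAdjoint.one A).sub ?_
  rw [IsSelfAdjoint, star_mul, star_mul, h.star_eq, hz.star_eq, h2.star_eq, ← hc.eq]
  exact (Commute.ofNat_right _ 2).eq

theorem continuousOn_sqrtSeries [CompleteSpace A] [NormOneClass A] {r : ℝ} (h0 : 0 ≤ r)
    (hr : r < 1 / 4) : ContinuousOn (sqrtSeries (A := A)) (Metric.closedBall 0 r) :=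
  continuousOn_const.sub
    (continuousOn_const.mul (continuousOn_id.mul (continuousOn_catalanSeries h0 hr)))

@[simp]
theorem sqrtSeries_zero : sqrtSeries (0 : A) = 1 := by simp [sqrtSeries]

end CatalanSeries

end DiagProj

namespace DiagProj

/-! ### Deforming a paved symmetry to an off-diagonal one -/

section Symmetries

/-- The self-adjoint unitaries that are off-diagonal with respect to the projection `e`. -/
def offDiagSymmetries {A : Type*} [Ring A] [Star A] (e : A) : Set A :=
  {v | IsSelfAdjoint v ∧ v * v = 1 ∧ e * v * e = 0 ∧ (1 - e) * v * (1 - e) = 0}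

theorem offDiagSymmetries_one_sub {A : Type*} [Ring A] [Star A] (e : A) :
    offDiagSymmetries (1 - e) = offDiagSymmetries e := by
  ext v
  simp only [offDiagSymmetries, Set.mem_ofPred_eq, sub_sub_cancel]
  tauto

/-- An off-diagonal `v` interchanges `e` and `1 - e`. In this form the rule moves `e` to the right
of `v`. -/
theorem mul_eq_sub_of_mem_offDiagSymmetries {A : Type*} [Ring A] [Star A] {e v : A}
    (hv : v ∈ offDiagSymmetries e) : e * v = v - v * e := by
  have h := hv.2.2.2
  have h' : (1 - e) * v * (1 - e) = v - v * e - e * v + e * v * e := by noncomm_ring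
  rw [h', hv.2.2.1, add_zero, sub_eq_zero] at h
  exact h.symm

/-- Conjugation of an off-diagonal symmetry by a unitary commuting with `e`. -/
theorem conj_mem_offDiagSymmetries {A : Type*} [Ring A] [StarRing A] {e v : A}
    (hv : v ∈ offDiagSymmetries e) {w : unitary A} (hw : Commute e (w : A))
    (he : IsSelfAdjoint e) : (w : A) * v * star (w : A) ∈ offDiagSymmetries e := by
  have hw' : Commute e (star (w : A)) := by
    have := hw.star_star
    rwa [he.star_eq] at this
  obtain ⟨h1, h2, h3, h4⟩ := hv
  have key : ∀ f : A, Commute f (w : A) → Commute f (star (w : A)) → f * v * f = 0 →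
      f * ((w : A) * v * star (w : A)) * f = 0 := fun f hf hf' h => by
    calc f * ((w : A) * v * star (w : A)) * f = (f * w) * v * (star (w : A) * f) := by
          simp only [mul_assoc]
      _ = w * (f * v * f) * star (w : A) := by rw [hf.eq, ← hf'.eq]; simp only [mul_assoc]
      _ = 0 := by rw [h, mul_zero, zero_mul]
  refine ⟨h1.conjugate _, ?_, key e hw hw' h3, key (1 - e) ?_ ?_ h4⟩
  · calc (w : A) * v * star (w : A) * (w * v * star (w : A))
        = w * v * (star (w : A) * w) * (v * star (w : A)) := by simp only [mul_assoc]
      _ = w * (v * v) * star (w : A) := by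
          rw [Unitary.coe_star_mul_self, mul_one]; simp only [mul_assoc]
      _ = 1 := by rw [h2, mul_one]; exact Unitary.coe_mul_star_self w
  · exact (Commute.one_left _).sub_left hw
  · exact (Commute.one_left _).sub_left hw'

/-- The block-diagonal part of a symmetry commutes with `e`, anticommutes with the off-diagonal
part, and their squares add up to one. -/
theorem blockDiag_relations {A : Type*} [Ring A] {e x : A} (he : e * e = e) (hx : x * x = 1) :
    let a := e * x * e + (1 - e) * x * (1 - e)
    let c := x - a
    Commute e a ∧ e * c * e = 0 ∧ (1 - e) * c * (1 - e) = 0 ∧ c * a = -(a * c) ∧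
      a * a + c * c = 1 := by
  have he' : ∀ w, e * (e * w) = e * w := fun w => by rw [← mul_assoc, he]
  have hx' : ∀ w, x * (x * w) = w := fun w => by rw [← mul_assoc, hx, one_mul]
  intro a c
  refine ⟨?_, ?_, ?_, ?_, ?_⟩ <;>
  · simp only [a, c, Commute, SemiconjBy, mul_add, add_mul, mul_sub, sub_mul, one_mul, mul_one,
      mul_assoc, he, he', hx, hx']
    abel

variable {𝕜 H : Type*} [RCLike 𝕜] [NormedAddCommGroup H] [InnerProductSpace 𝕜 H] [CompleteSpace H]

theorem inner_isStarProjection {e : H →L[𝕜] H} (he : IsStarProjection e) (x y : H) :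
    inner 𝕜 (e x) y = inner 𝕜 x (e y) := by
  rw [← ContinuousLinearMap.adjoint_inner_right, ← ContinuousLinearMap.star_eq_adjoint,
    he.isSelfAdjoint.star_eq]

theorem isStarProjection_apply_apply {e : H →L[𝕜] H} (he : IsStarProjection e) (x : H) :
    e (e x) = e x := DFunLike.congr_fun he.isIdempotentElem.eq x

theorem norm_sq_eq_of_isStarProjection {e : H →L[𝕜] H} (he : IsStarProjection e) (y : H) :
    ‖y‖ ^ 2 = ‖e y‖ ^ 2 + ‖(1 - e) y‖ ^ 2 := by
  have h : inner 𝕜 (e y) ((1 - e) y) = 0 := by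
    rw [inner_isStarProjection he]
    simp [isStarProjection_apply_apply he]
  have := norm_add_sq_eq_norm_sq_add_norm_sq_of_inner_eq_zero (𝕜 := 𝕜) (e y) ((1 - e) y) h
  simpa [sq] using this

/-- The two blocks act on orthogonal summands, so by Pythagoras the norm is at most the larger of
theirs. -/
theorem norm_blockDiag_lt_one {e x : H →L[𝕜] H} (he : IsStarProjection e)
    (h1 : ‖e * x * e‖ < 1) (h2 : ‖(1 - e) * x * (1 - e)‖ < 1) :
    ‖e * x * e + (1 - e) * x * (1 - e)‖ < 1 := by
  set m := max ‖e * x * e‖ ‖(1 - e) * x * (1 - e)‖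
  have hm : 0 ≤ m := le_max_of_le_left (norm_nonneg _)
  refine lt_of_le_of_lt (ContinuousLinearMap.opNorm_le_bound _ hm fun y => ?_) (max_lt h1 h2)
  refine le_of_sq_le_sq ?_ (by positivity)
  have hee := he.isIdempotentElem.eq
  have e1 : e * (e * x * e + (1 - e) * x * (1 - e)) = e * x * e * e := by
    simp only [mul_add, ← mul_assoc, mul_sub, mul_one, hee, sub_self, zero_mul, add_zero]
    rw [mul_assoc (e * x), hee]
  have e2 : (1 - e) * (e * x * e + (1 - e) * x * (1 - e)) =
      (1 - e) * x * (1 - e) * (1 - e) := by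
    have hff := he.one_sub.isIdempotentElem.eq
    have hfe : (1 - e) * e = 0 := by rw [sub_mul, one_mul, hee, sub_self]
    rw [mul_add, ← mul_assoc, ← mul_assoc, hfe, zero_mul, zero_mul, zero_add,
      ← mul_assoc, ← mul_assoc, hff, mul_assoc ((1 - e) * x), hff]
  rw [norm_sq_eq_of_isStarProjection he, mul_pow, norm_sq_eq_of_isStarProjection he y, mul_add]
  have b1 := ((e * x * e).le_of_opNorm_le (le_max_left _ _ : _ ≤ m) (e y))
  have b2 := (((1 - e) * x * (1 - e)).le_of_opNorm_le (le_max_right _ _ : _ ≤ m) ((1 - e) y))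
  have c1 : e ((e * x * e + (1 - e) * x * (1 - e)) y) = (e * x * e) (e y) :=
    DFunLike.congr_fun e1 y
  have c2 : (1 - e) ((e * x * e + (1 - e) * x * (1 - e)) y) =
      ((1 - e) * x * (1 - e)) ((1 - e) y) := DFunLike.congr_fun e2 y
  rw [c1, c2, ← mul_pow, ← mul_pow]
  gcongr

/-- A symmetry whose block-diagonal part has norm less than one is deformed to an off-diagonal
symmetry by scaling its block-diagonal part `a` linearly to zero. -/
theorem exists_path_to_offDiagSymmetries [Nontrivial H] {e x : H →L[𝕜] H}
    (he : IsStarProjection e) (hx : IsSelfAdjoint x) (hxx : x * x = 1)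
    (h1 : ‖e * x * e‖ < 1) (h2 : ‖(1 - e) * x * (1 - e)‖ < 1) :
    ∃ v ∈ offDiagSymmetries e, JoinedIn {y | IsSelfAdjoint y ∧ y * y = 1 ∧
      ∃ (t : 𝕜) (z : H →L[𝕜] H), e * z * e = 0 ∧ (1 - e) * z * (1 - e) = 0 ∧
        y = t • (e * x * e + (1 - e) * x * (1 - e)) + z} x v := by
  obtain ⟨hea, hc1, hc2, hca, hac⟩ := blockDiag_relations he.isIdempotentElem.eq hxx
  have hnorm := norm_blockDiag_lt_one he h1 h2
  have hsa : IsSelfAdjoint (e * x * e + (1 - e) * x * (1 - e)) := by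
    have i1 := hx.conjugate e
    have i2 := hx.conjugate (1 - e)
    rw [he.isSelfAdjoint.star_eq] at i1
    rw [he.one_sub.isSelfAdjoint.star_eq] at i2
    exact i1.add i2
  set a := e * x * e + (1 - e) * x * (1 - e)
  obtain ⟨c, hc⟩ : ∃ c, c = x - a := ⟨_, rfl⟩
  rw [← hc] at hc1 hc2 hca hac
  have hcs : IsSelfAdjoint c := hc ▸ hx.sub hsa
  have hcaa : Commute c (a * a) := by
    rw [Commute, SemiconjBy, ← mul_assoc, hca, neg_mul, mul_assoc, hca, mul_neg, neg_neg, mul_assoc]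
  -- `sqrtSeries` is a root of `1 - 4z`, so the factor `1 / 4` makes `s t` below a square root of `1
  -- - t² a²`.
  let z : ℝ → H →L[𝕜] H := fun t => ((t ^ 2 / 4 : ℝ) : 𝕜) • (a * a)
  have hzn : ∀ t ∈ Set.Icc (0 : ℝ) 1, ‖z t‖ ≤ ‖a‖ ^ 2 / 4 := fun t ht => by
    have ht2 : t ^ 2 ≤ 1 := pow_le_one₀ ht.1 ht.2
    calc ‖z t‖ = t ^ 2 / 4 * ‖a * a‖ := by
          rw [norm_smul, RCLike.norm_ofReal, abs_of_nonneg (by positivity)]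
      _ ≤ 1 / 4 * (‖a‖ * ‖a‖) := by gcongr; exact norm_mul_le _ _
      _ = ‖a‖ ^ 2 / 4 := by ring
  have hr : ‖a‖ ^ 2 / 4 < 1 / 4 := by
    have := pow_lt_one₀ (norm_nonneg a) hnorm two_ne_zero
    linarith
  have hz4 : ∀ t, 4 * z t = ((t : 𝕜) * (t : 𝕜)) • (a * a) := fun t => by
    have : (4 : H →L[𝕜] H) = (4 : 𝕜) • 1 := by
      ext y; simp [ofNat_smul_eq_nsmul]
    rw [this, smul_mul_assoc, one_mul, smul_smul]
    congr 1
    push_cast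
    ring
  have hzcomm : ∀ {y : H →L[𝕜] H} (t : ℝ), Commute y (a * a) → Commute y (z t) :=
    fun t h => h.smul_right _
  let s : ℝ → H →L[𝕜] H := fun t => sqrtSeries (z t)
  have hss : ∀ t ∈ Set.Icc (0 : ℝ) 1, s t * s t = 1 - ((t : 𝕜) * (t : 𝕜)) • (a * a) :=
    fun t ht => by rw [sqrtSeries_mul_self ((hzn t ht).trans_lt hr), hz4]
  have hscomm : ∀ {y : H →L[𝕜] H} (t : ℝ), Commute y (a * a) → Commute y (s t) :=
    fun t h => Commute.sqrtSeries_right (hzcomm t h)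
  have hssa : ∀ t, IsSelfAdjoint (s t) := fun t => by
    refine isSelfAdjoint_sqrtSeries (IsSelfAdjoint.smul ?_ ?_)
    · simp [IsSelfAdjoint]
    · rw [IsSelfAdjoint, star_mul, hsa.star_eq]
  have haa : Commute a (a * a) := (Commute.refl a).mul_right (Commute.refl a)
  have hs1 : s 1 * s 1 = 1 - a * a := by simpa using hss 1 (by simp)
  have hunit : IsUnit (s 1) := by
    have : IsUnit (s 1 ^ 2) := by
      rw [sq, hs1]
      refine isUnit_one_sub_of_norm_lt_one ((norm_mul_le a a).trans_lt ?_)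
      rw [← sq]
      exact pow_lt_one₀ (norm_nonneg a) hnorm two_ne_zero
    exact (isUnit_pow_iff two_ne_zero).1 this
  obtain ⟨S, hS⟩ := hunit
  set r : H →L[𝕜] H := ↑S⁻¹
  have hsr : s 1 * r = 1 := by rw [← hS]; exact S.mul_inv
  have hrs : r * s 1 = 1 := by rw [← hS]; exact S.inv_mul
  have hrcomm : ∀ {y : H →L[𝕜] H}, Commute y (a * a) → Commute y r := fun h => by
    have := hscomm 1 h
    rw [← hS] at this
    exact this.units_inv_right
  have hrsa : IsSelfAdjoint r := by
    calc star r = star r * (s 1 * r) := by rw [hsr, mul_one]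
      _ = star (s 1 * r) * r := by rw [star_mul, (hssa 1).star_eq, mul_assoc]
      _ = r := by rw [hsr, star_one, one_mul]
  have hcr : Commute c r := hrcomm hcaa
  have heaa : Commute e (a * a) := hea.mul_right hea
  -- Here `r` is the inverse of `s 1`. Since `c² = 1 - a² = (s 1)²` and everything commutes with
  -- `a²`, `v` is the unitary factor in `c = v * s 1`.
  set v := c * r with hv
  have hoff : ∀ f : H →L[𝕜] H, Commute f (a * a) → f * c * f = 0 → ∀ t,
      f * (v * s t) * f = 0 := fun f hf h t => by
    calc f * (v * s t) * f = f * c * (r * s t * f) := by rw [hv]; simp only [mul_assoc]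
      _ = f * c * f * (r * s t) := by
        rw [((hrcomm hf).mul_right (hscomm t hf)).symm.eq]; simp only [mul_assoc]
      _ = 0 := by rw [h, zero_mul]
  have hvsa : IsSelfAdjoint v := by
    rw [IsSelfAdjoint, hv, star_mul, hrsa.star_eq, hcs.star_eq, hcr.eq]
  have hcc : c * c = s 1 * s 1 := by rw [hs1, ← hac, add_sub_cancel_left]
  have hvv : v * v = 1 := by
    calc v * v = c * (r * c) * r := by rw [hv]; simp only [mul_assoc]
      _ = c * c * r * r := by rw [← hcr.eq]; simp only [mul_assoc]
      _ = s 1 * (s 1 * r) * r := by rw [hcc]; simp only [mul_assoc]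
      _ = 1 := by rw [hsr, mul_one, hsr]
  have hva : v * a = -(a * v) := by
    rw [hv, mul_assoc, ← (hrcomm haa).eq, ← mul_assoc, hca, neg_mul, mul_assoc]
  have hvaa : Commute v (a * a) := by
    rw [Commute, SemiconjBy, ← mul_assoc, hva, neg_mul, mul_assoc, hva, mul_neg, neg_neg, mul_assoc]
  have hs0 : s 0 = 1 := by simp [s, z]
  have hoffv : ∀ f : H →L[𝕜] H, Commute f (a * a) → f * c * f = 0 → f * v * f = 0 :=
    fun f hf h => by simpa [hs0] using hoff f hf h 0
  have hfaa : Commute (1 - e) (a * a) := (Commute.one_left _).sub_left heaa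
  refine ⟨v, ⟨hvsa, hvv, hoffv e heaa hc1, hoffv (1 - e) hfaa hc2⟩, JoinedIn.symm ?_⟩
  -- The line runs from `v` at `t = 0` to `x` at `t = 1`. Its square is `1` because `v * s t`
  -- anticommutes with `a` and squares to `1 - t² a²`.
  refine JoinedIn.ofLine (f := fun t : ℝ => (t : 𝕜) • a + v * s t) ?_ ?_ ?_ ?_
  · have hs : ContinuousOn s (Set.Icc 0 1) := by
      refine (continuousOn_sqrtSeries (by positivity) hr).comp ?_ fun t ht => by
        simpa using hzn t ht
      have : Continuous fun t : ℝ => ((t ^ 2 / 4 : ℝ) : 𝕜) :=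
        RCLike.continuous_ofReal.comp (by fun_prop)
      exact (this.smul continuous_const).continuousOn
    have ht : Continuous fun t : ℝ => (t : 𝕜) • a :=
      
      (RCLike.continuous_ofReal (K := 𝕜)).smul continuous_const
    exact ht.continuousOn.add (continuousOn_const.mul hs)
  · simp [hs0]
  · simp only [RCLike.ofReal_one, one_smul]
    rw [hv, mul_assoc, hrs, mul_one, hc, add_sub_cancel]
  · rintro _ ⟨t, ht, rfl⟩
    refine ⟨?_, ?_, (t : 𝕜), v * s t, hoff e heaa hc1 t, hoff (1 - e) hfaa hc2 t, rfl⟩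
    · refine (IsSelfAdjoint.smul (by simp [IsSelfAdjoint]) hsa).add ?_
      rw [IsSelfAdjoint, star_mul, (hssa t).star_eq, hvsa.star_eq, (hscomm t hvaa).eq]
    · have hav : a * (v * s t) + v * s t * a = 0 := by
        rw [mul_assoc v, ← (hscomm t haa).eq, ← mul_assoc v, hva, ← mul_assoc, neg_mul,
          add_neg_cancel]
      have hvsvs : v * s t * (v * s t) = s t * s t := by
        conv_lhs => rw [(hscomm t hvaa).eq, mul_assoc, ← (hscomm t hvaa).eq, ← mul_assoc v, hvv,
          one_mul]
      calc ((t : 𝕜) • a + v * s t) * ((t : 𝕜) • a + v * s t)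
          = ((t : 𝕜) * (t : 𝕜)) • (a * a) + (t : 𝕜) • (a * (v * s t) + v * s t * a) +
              v * s t * (v * s t) := by
            simp only [mul_add, add_mul, smul_mul_assoc, mul_smul_comm, smul_add, smul_smul]
            abel
        _ = 1 := by rw [hav, hvsvs, hss t ht]; simp

end Symmetries

end DiagProj

namespace DiagProj

/-! ### Connectedness of the off-diagonal symmetries of one projection -/

section OffDiagonal

variable {𝕜 H ι : Type*} [RCLike 𝕜] [NormedAddCommGroup H] [InnerProductSpace 𝕜 H]

/-- Distinct members are at distance `√2`, so balls of radius `1 / 2` around them are disjoint open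
sets in a separable space. -/
theorem countable_of_orthonormal [TopologicalSpace.SeparableSpace H] {v : ι → H}
    (hv : Orthonormal 𝕜 v) : Countable ι := by
  have hd : ∀ i j, i ≠ j → 1 ≤ dist (v i) (v j) := fun i j hij => by
    have h := norm_sub_sq (𝕜 := 𝕜) (v i) (v j)
    rw [hv.1, hv.1, hv.2 hij] at h
    rw [dist_eq_norm]
    norm_num at h
    nlinarith [norm_nonneg (v i - v j)]
  have hdisj : (Set.univ : Set ι).PairwiseDisjoint fun i => Metric.ball (v i) (1 / 2) :=
    fun i _ j _ hij => Metric.ball_disjoint_ball (by linarith [hd i j hij])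
  have := hdisj.countable_of_isOpen (fun i _ => Metric.isOpen_ball)
    fun i _ => ⟨v i, Metric.mem_ball_self (by norm_num)⟩
  exact Set.countable_univ_iff.1 this

variable [CompleteSpace H]

/-- The kernel is the range of `e`. Since `e + v e v = 1`, this range and its image under `v` span
`H`. -/
theorem not_finiteDimensional_ker {e v : H →L[𝕜] H} (hv : v ∈ offDiagSymmetries e)
    (he : e * e = e) (hH : ¬ FiniteDimensional 𝕜 H) :
    ¬ FiniteDimensional 𝕜 (LinearMap.ker (1 - e : H →L[𝕜] H).toLinearMap) := by
  intro hfin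
  set M := LinearMap.ker (1 - e : H →L[𝕜] H).toLinearMap
  have hmem : ∀ y, e y ∈ M := fun y => by
    have : (1 - e) * e = 0 := by rw [sub_mul, one_mul, he, sub_self]
    exact DFunLike.congr_fun this y
  have hveve : e + v * (e * v) = 1 := by
    rw [mul_eq_sub_of_mem_offDiagSymmetries hv, mul_sub, ← mul_assoc, hv.2.1, one_mul,
      add_sub_cancel]
  have htop : (⊤ : Submodule 𝕜 H) = M ⊔ M.map v.toLinearMap := by
    refine (eq_top_iff.2 fun y _ => ?_).symm
    have hy : y = e y + v (e (v y)) := (DFunLike.congr_fun hveve y).symm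
    rw [hy]
    exact Submodule.add_mem_sup (hmem y) ⟨_, hmem _, rfl⟩
  have : FiniteDimensional 𝕜 (⊤ : Submodule 𝕜 H) := by
    rw [htop]; infer_instance
  exact hH (Module.Finite.equiv (Submodule.topEquiv (R := 𝕜) (M := H)))

/-- The off-diagonal symmetries with respect to a projection form a path connected set. -/
theorem joinedIn_offDiagSymmetries [TopologicalSpace.SeparableSpace H] {e v v₀ : H →L[𝕜] H}
    (he : IsStarProjection e) (hv : v ∈ offDiagSymmetries e) (hv₀ : v₀ ∈ offDiagSymmetries e)
    (hH : ¬ FiniteDimensional 𝕜 H) : JoinedIn (offDiagSymmetries e) v₀ v := by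
  have hee := he.isIdempotentElem.eq
  have hM := not_finiteDimensional_ker hv hee hH
  set M := LinearMap.ker (1 - e : H →L[𝕜] H).toLinearMap with hMdef
  have hmem : ∀ y, y ∈ M ↔ e y = y := fun y => by
    have : y ∈ M ↔ y - e y = 0 := Iff.rfl
    rw [this, sub_eq_zero, eq_comm]
  have hclosed : IsClosed (M : Set H) := (1 - e : H →L[𝕜] H).isClosed_ker
  have : CompleteSpace M := hclosed.completeSpace_coe
  obtain ⟨s, b, -⟩ := exists_hilbertBasis 𝕜 M
  have : Countable s := countable_of_orthonormal b.orthonormal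
  have hV : ∀ y, M.subtypeₗᵢ (coisometry M.subtypeₗᵢ y) = e y := fun y => by
    have h : coisometry M.subtypeₗᵢ y = ⟨e y, (hmem _).2 (isStarProjection_apply_apply he y)⟩ :=
      ext_inner_left 𝕜 fun x => by
        rw [inner_coisometry_right]
        change inner 𝕜 (x : H) y = inner 𝕜 (x : H) (e y)
        rw [← inner_isStarProjection he, (hmem _).1 x.2]
    rw [h]; rfl
  have r1 := mul_eq_sub_of_mem_offDiagSymmetries hv
  have r2 := mul_eq_sub_of_mem_offDiagSymmetries hv₀
  have assoc : ∀ {x y z : H →L[𝕜] H}, x * y = z → ∀ w, x * (y * w) = z * w := fun h w => by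
    rw [← mul_assoc, h]
  have r1' := assoc r1
  have r2' := assoc r2
  have r3' := assoc hee
  have r4' := assoc hv.2.1
  have r5' := assoc hv₀.2.1
  -- Both symmetries swap the ranges of `e` and `1 - e`, so `v v₀` preserves the range of `e`.
  -- Acting by it there and trivially on the complement conjugates `v₀` into `v`.
  let W : H →L[𝕜] H := v * v₀ * e + (1 - e)
  have hWs : star W = v₀ * v * e + (1 - e) := by
    simp only [W, star_add, star_sub, star_mul, star_one, he.isSelfAdjoint.star_eq,
      hv.1.star_eq, hv₀.1.star_eq]
    congr 1
    simp only [r1, r2', mul_sub, sub_mul, mul_assoc]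
    abel
  have hW : W ∈ unitary (H →L[𝕜] H) := by
    rw [Unitary.mem_iff, hWs]
    constructor <;>
    · simp only [W, mul_add, add_mul, mul_sub, sub_mul, mul_one, one_mul, mul_assoc, r1',
        r2', hee, r4', r5']
      abel
  have hWv : W * v₀ * star W = v := by
    rw [hWs]
    simp only [W, mul_add, add_mul, mul_sub, sub_mul, mul_one, one_mul, mul_assoc, r2, r1',
      r2', hee, hv₀.2.1, r5']
    abel
  obtain ⟨w, hw⟩ := exists_extendUnitary_eq M ⟨W, hW⟩ fun y hy => by
    have hey : e y = 0 := by
      rw [← inner_self_eq_zero (𝕜 := 𝕜), inner_isStarProjection he,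
        isStarProjection_apply_apply he, inner_eq_zero_symm]
      exact (Submodule.mem_orthogonal _ _).1 hy _ ((hmem _).2 (isStarProjection_apply_apply he y))
    simp [W, hey]
  have hjoin := mem_identityPathComponent.1 (unitary_mem_identityPathComponent b hM w)
  have hcomm : ∀ w : unitary (M →L[𝕜] M),
      Commute e (extendUnitary M.subtypeₗᵢ w : H →L[𝕜] H) := fun w => by
    have h1 : ∀ x : M, e (M.subtypeₗᵢ x) = M.subtypeₗᵢ x := fun x => (hmem _).1 x.2
    have h2 : ∀ y, coisometry M.subtypeₗᵢ (e y) = coisometry M.subtypeₗᵢ y := fun y =>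
      M.subtypeₗᵢ.injective (by rw [hV, hV, isStarProjection_apply_apply he])
    refine ContinuousLinearMap.ext fun y => ?_
    rw [mul_apply_eq_comp, mul_apply_eq_comp, coe_extendUnitary, extendOp_apply, extendOp_apply,
      hV, hV, h2, map_add, h1, map_sub]
  have hpath := (joinedIn_univ.2 hjoin).map_continuousOn
    (f := fun w => (extendUnitary M.subtypeₗᵢ w : H →L[𝕜] H) * v₀ *
      star (extendUnitary M.subtypeₗᵢ w : H →L[𝕜] H)) (by
    have := continuous_subtype_val.comp (continuous_extendUnitary M.subtypeₗᵢ)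
    exact ((this.mul continuous_const).mul (continuous_star.comp this)).continuousOn)
  rw [hw, map_one] at hpath
  simp only [hWv, OneMemClass.coe_one, star_one, one_mul, mul_one] at hpath
  refine hpath.mono ?_
  rintro _ ⟨w, -, rfl⟩
  exact conj_mem_offDiagSymmetries hv₀ (hcomm w) he.isSelfAdjoint

end OffDiagonal

end DiagProj

namespace DiagProj

/-! ### Splitting index sets and swapping their cells -/

section Combinatorics

variable {ι : Type*}

theorem exists_infinite_split {s : Set ι} (hs : s.Infinite) :
    ∃ t ⊆ s, t.Infinite ∧ (s \ t).Infinite := by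
  have := hs.to_subtype
  obtain ⟨f⟩ : Nonempty (ℕ ↪ s) := ⟨Infinite.natEmbedding s⟩
  have hinj : Function.Injective fun n => (f n : ι) := Subtype.val_injective.comp f.injective
  refine ⟨Set.range fun n => (f (2 * n) : ι), ?_, ?_, ?_⟩
  · rintro _ ⟨n, rfl⟩
    exact (f _).2
  · exact Set.infinite_range_of_injective fun m n h => by
      have := hinj h; omega
  · refine (Set.infinite_range_of_injective (f := fun n => (f (2 * n + 1) : ι)) fun m n h => by
      have := hinj h; omega).mono ?_
    rintro _ ⟨n, rfl⟩
    refine ⟨(f _).2, ?_⟩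
    rintro ⟨m, hm⟩
    have := hinj hm
    omega

/-- For every partition there is a set splitting each infinite class into two infinite parts. -/
theorem exists_splitting_set {κ : Type*} (φ : ι → κ) : ∃ C : Set ι, ∀ k,
    (φ ⁻¹' {k}).Infinite → (φ ⁻¹' {k} ∩ C).Infinite ∧ (φ ⁻¹' {k} ∩ Cᶜ).Infinite := by
  choose! t hts ht1 ht2 using fun k (h : (φ ⁻¹' {k}).Infinite) => exists_infinite_split h
  refine ⟨{i | i ∈ t (φ i)}, fun k hk => ⟨(ht1 k hk).mono fun i hi => ?_,
    (ht2 k hk).mono fun i hi => ?_⟩⟩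
  · have h : φ i = k := hts k hk hi
    exact ⟨h, by simpa [h] using hi⟩
  · have h : φ i = k := hi.1
    exact ⟨h, by simpa [h] using hi.2⟩

/-- Two subsets whose four intersections are all infinite are interchanged with their complements
by a common involution. -/
theorem exists_swapping_involution [Countable ι] {A C : Set ι} (h1 : (A ∩ C).Infinite)
    (h2 : (A ∩ Cᶜ).Infinite) (h3 : (Aᶜ ∩ C).Infinite) (h4 : (Aᶜ ∩ Cᶜ).Infinite) :
    ∃ σ : ι → ι, Function.Involutive σ ∧ (∀ i, σ i ∈ A ↔ i ∉ A) ∧ ∀ i, σ i ∈ C ↔ i ∉ C := by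
  classical
  let φ : ι → Prop × Prop := fun i => (i ∈ A, i ∈ C)
  have hfib : ∀ k, Infinite {i // φ i = k} := by
    rintro ⟨p, q⟩
    by_cases hp : p <;> by_cases hq : q
    · exact (h1.mono fun i hi => show φ i = _ by simpa [φ, hp, hq] using hi).to_subtype
    · exact (h2.mono fun i hi => show φ i = _ by simpa [φ, hp, hq] using hi).to_subtype
    · exact (h3.mono fun i hi => show φ i = _ by simpa [φ, hp, hq] using hi).to_subtype
    · exact (h4.mono fun i hi => show φ i = _ by simpa [φ, hp, hq] using hi).to_subtype
  have hden : ∀ k, Nonempty ({i // φ i = k} ≃ ℕ) := fun k => by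
    obtain ⟨h⟩ := nonempty_denumerable {i // φ i = k}
    exact ⟨Denumerable.eqv _⟩
  let g := fun k => (hden k).some
  let G : ι ≃ (Prop × Prop) × ℕ := (Equiv.sigmaFiberEquiv φ).symm.trans
    ((Equiv.sigmaCongrRight g).trans (Equiv.sigmaEquivProd _ _))
  have hG : ∀ i, (G i).1 = φ i := fun i => rfl
  -- Each of the four cells is numbered by `ℕ`. Negating both memberships exchanges opposite cells
  -- and keeps the number.
  let τ : (Prop × Prop) × ℕ → (Prop × Prop) × ℕ := fun x => ((¬ x.1.1, ¬ x.1.2), x.2)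
  have hτ : ∀ x, τ (τ x) = x := fun x => by simp [τ]
  have hφ : ∀ i, φ (G.symm (τ (G i))) = (τ (G i)).1 := fun i => by
    rw [← hG, Equiv.apply_symm_apply]
  refine ⟨fun i => G.symm (τ (G i)), fun i => by simp [hτ], fun i => ?_, fun i => ?_⟩
  · exact iff_of_eq (congrArg Prod.fst (hφ i))
  · exact iff_of_eq (congrArg Prod.snd (hφ i))

/-- Split every infinite cell of the partition generated by `A` and `B`. Each of the four given sets
is a union of two cells, at least one of them infinite. -/
theorem exists_common_splitting {A B : Set ι} (hA : A.Infinite)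
    (hA' : Aᶜ.Infinite) (hB : B.Infinite) (hB' : Bᶜ.Infinite) : ∃ C : Set ι,
    ((A ∩ C).Infinite ∧ (A ∩ Cᶜ).Infinite ∧ (Aᶜ ∩ C).Infinite ∧ (Aᶜ ∩ Cᶜ).Infinite) ∧
    ((B ∩ C).Infinite ∧ (B ∩ Cᶜ).Infinite ∧ (Bᶜ ∩ C).Infinite ∧ (Bᶜ ∩ Cᶜ).Infinite) := by
  obtain ⟨C, hC⟩ := exists_splitting_set fun i => ((i ∈ A, i ∈ B) : Prop × Prop)
  have key : ∀ {S T : Set ι}, S.Infinite →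
      (∃ k, (fun i => ((i ∈ A, i ∈ B) : Prop × Prop)) ⁻¹' {k} = S ∩ T) →
      (∃ k, (fun i => ((i ∈ A, i ∈ B) : Prop × Prop)) ⁻¹' {k} = S ∩ Tᶜ) →
      (S ∩ C).Infinite ∧ (S ∩ Cᶜ).Infinite := by
    rintro S T hS ⟨k, hk⟩ ⟨l, hl⟩
    rw [← Set.inter_union_compl S T, Set.infinite_union] at hS
    rcases hS with h | h
    · have := hC k (by rwa [hk])
      rw [hk] at this
      exact ⟨this.1.mono (by grind), this.2.mono (by grind)⟩
    · have := hC l (by rwa [hl])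
      rw [hl] at this
      exact ⟨this.1.mono (by grind), this.2.mono (by grind)⟩
  have c1 : (fun i => ((i ∈ A, i ∈ B) : Prop × Prop)) ⁻¹' {(True, True)} = A ∩ B := by
    ext i; simp
  have c2 : (fun i => ((i ∈ A, i ∈ B) : Prop × Prop)) ⁻¹' {(True, False)} = A ∩ Bᶜ := by
    ext i; simp
  have c3 : (fun i => ((i ∈ A, i ∈ B) : Prop × Prop)) ⁻¹' {(False, True)} = Aᶜ ∩ B := by
    ext i; simp
  have c4 : (fun i => ((i ∈ A, i ∈ B) : Prop × Prop)) ⁻¹' {(False, False)} = Aᶜ ∩ Bᶜ := by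
    ext i; simp
  have d1 := key hA ⟨_, c1⟩ ⟨_, c2⟩
  have d2 := key hA' ⟨_, c3⟩ ⟨_, c4⟩
  have d3 := key hB ⟨_, c1.trans (Set.inter_comm _ _)⟩ ⟨_, c3.trans (Set.inter_comm _ _)⟩
  have d4 := key hB' ⟨_, c2.trans (Set.inter_comm _ _)⟩ ⟨_, c4.trans (Set.inter_comm _ _)⟩
  exact ⟨C, ⟨d1.1, d1.2, d2.1, d2.2⟩, d3.1, d3.2, d4.1, d4.2⟩

end Combinatorics

/-! ### Coordinate projections and zero diagonals -/

section Coordinates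

variable {𝕜 H ι : Type*} [RCLike 𝕜] [NormedAddCommGroup H] [InnerProductSpace 𝕜 H]

/-- The operator `e` fixes the basis vectors indexed by `A` and kills the others. -/
def IsCoordinateProjection (b : HilbertBasis ι 𝕜 H) (A : Set ι) (e : H →L[𝕜] H) : Prop :=
  (∀ i ∈ A, e (b i) = b i) ∧ ∀ i ∉ A, e (b i) = 0

theorem IsCoordinateProjection.one_sub {b : HilbertBasis ι 𝕜 H} {A : Set ι} {e : H →L[𝕜] H}
    (h : IsCoordinateProjection b A e) : IsCoordinateProjection b Aᶜ (1 - e) :=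
  ⟨fun i hi => by simp [h.2 i hi], fun i hi => by simp [h.1 i (Set.notMem_compl_iff.1 hi)]⟩

theorem ext_inner_hilbertBasis (b : HilbertBasis ι 𝕜 H) {x y : H}
    (h : ∀ i, inner 𝕜 (b i) x = inner 𝕜 (b i) y) : x = y := by
  refine b.repr.injective (lp.ext (funext fun i => ?_))
  rw [b.repr_apply_apply, b.repr_apply_apply, h]

theorem compression_eq_zero {b : HilbertBasis ι 𝕜 H} {A : Set ι} {e v : H →L[𝕜] H}
    (hA : IsCoordinateProjection b A e) {σ : ι → ι} (hσ : ∀ i, σ i ∈ A ↔ i ∉ A)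
    (hv : ∀ i, v (b i) = b (σ i)) : e * v * e = 0 := by
  refine ext_hilbertBasis b fun i => ?_
  change e (v (e (b i))) = 0
  by_cases hi : i ∈ A
  · rw [hA.1 i hi, hv, hA.2]
    exact fun h => (hσ i).1 h hi
  · rw [hA.2 i hi, map_zero, map_zero]

variable [CompleteSpace H]

theorem exists_isCoordinateProjection (b : HilbertBasis ι 𝕜 H) (A : Set ι) :
    ∃ e : H →L[𝕜] H, IsStarProjection e ∧ IsCoordinateProjection b A e := by
  set K := (Submodule.span 𝕜 (b '' A)).topologicalClosure
  have : CompleteSpace K :=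
    (Submodule.isClosed_topologicalClosure _).completeSpace_coe
  refine ⟨K.starProjection, isStarProjection_starProjection, fun i hi => ?_, fun i hi => ?_⟩
  · exact Submodule.starProjection_eq_self_iff.2
      (Submodule.le_topologicalClosure _ (Submodule.subset_span ⟨i, hi, rfl⟩))
  · rw [Submodule.starProjection_apply_eq_zero_iff, Submodule.orthogonal_closure,
      Submodule.mem_orthogonal]
    intro y hy
    induction hy using Submodule.span_induction with
    | mem x hx =>
      obtain ⟨j, hj, rfl⟩ := hx
      exact b.orthonormal.2 fun h => hi (h ▸ hj)
    | zero => simp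
    | add x y _ _ hx hy => rw [inner_add_left, hx, hy, add_zero]
    | smul c x _ hx => rw [inner_smul_left, hx, mul_zero]

/-- A basis vector is an eigenvector of `e`, and idempotence forces its eigenvalue to be `0` or `1`.
-/
theorem IsDiagonal.isCoordinateProjection {b : HilbertBasis ι 𝕜 H} {e : H →L[𝕜] H}
    (hd : IsDiagonal b e) (he : IsStarProjection e) :
    IsCoordinateProjection b {i | e (b i) ≠ 0} e := by
  refine ⟨fun i hi => ?_, fun i hi => not_not.1 hi⟩
  have h1 : e (b i) = inner 𝕜 (b i) (e (b i)) • b i := by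
    classical
    refine ext_inner_hilbertBasis b fun j => ?_
    rw [inner_smul_right, orthonormal_iff_ite.1 b.orthonormal]
    split_ifs with h
    · rw [h, mul_one]
    · rw [hd j i h, mul_zero]
  set c := inner 𝕜 (b i) (e (b i))
  have h2 := isStarProjection_apply_apply he (b i)
  rw [h1, map_smul, h1, smul_smul] at h2
  have hb : b i ≠ 0 := b.orthonormal.ne_zero i
  have hc : c ≠ 0 := fun h => hi (by rw [h1, h, zero_smul])
  have h3 : c * c = c := smul_left_injective 𝕜 hb h2
  rw [h1, mul_left_cancel₀ hc (h3.trans (mul_one c).symm), one_smul]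

/-- For finite `A` the range of `e` would lie in a finite-dimensional span, against
`not_finiteDimensional_ker`. -/
theorem infinite_of_mem_offDiagSymmetries {b : HilbertBasis ι 𝕜 H} {A : Set ι} {e v : H →L[𝕜] H}
    (hA : IsCoordinateProjection b A e) (he : e * e = e) (hv : v ∈ offDiagSymmetries e)
    (hH : ¬ FiniteDimensional 𝕜 H) : A.Infinite := by
  intro hfin
  refine not_finiteDimensional_ker hv he hH ?_
  set T := Submodule.span 𝕜 (b '' A)
  have hT : FiniteDimensional 𝕜 T := FiniteDimensional.span_of_finite 𝕜 (hfin.image b)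
  have hcl : IsClosed (T : Set H) := T.closed_of_finiteDimensional
  have hle : ∀ y, e y ∈ T := by
    have hpre : IsClosed (e ⁻¹' (T : Set H)) := hcl.preimage e.continuous
    have hspan : Submodule.span 𝕜 (Set.range b) ≤ T.comap e.toLinearMap := by
      rw [Submodule.span_le]
      rintro _ ⟨i, rfl⟩
      by_cases hi : i ∈ A
      · exact (congrArg (· ∈ T) (hA.1 i hi)).mpr (Submodule.subset_span ⟨i, hi, rfl⟩)
      · exact (congrArg (· ∈ T) (hA.2 i hi)).mpr T.zero_mem
    have hdense : Dense (Submodule.span 𝕜 (Set.range b) : Set H) :=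
      Submodule.dense_iff_topologicalClosure_eq_top.2 b.dense_span
    exact fun y => (hpre.closure_subset_iff.2 hspan) (hdense y)
  refine Submodule.finiteDimensional_of_le (S₂ := T) fun y hy => ?_
  have : e y = y := (sub_eq_zero.1 (show y - e y = 0 from hy)).symm
  rw [← this]
  exact hle y

/-- Two coordinate projections in general position have a common off-diagonal symmetry. -/
theorem exists_common_offDiagSymmetry [Countable ι] {b : HilbertBasis ι 𝕜 H} {A C : Set ι}
    {e f : H →L[𝕜] H} (hA : IsCoordinateProjection b A e) (hC : IsCoordinateProjection b C f)
    (h : (A ∩ C).Infinite ∧ (A ∩ Cᶜ).Infinite ∧ (Aᶜ ∩ C).Infinite ∧ (Aᶜ ∩ Cᶜ).Infinite) :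
    ∃ v, v ∈ offDiagSymmetries e ∧ v ∈ offDiagSymmetries f := by
  obtain ⟨σ, hσ, hσA, hσC⟩ := exists_swapping_involution h.1 h.2.1 h.2.2.1 h.2.2.2
  have hon : Orthonormal 𝕜 fun i => b (σ i) := b.orthonormal.comp σ hσ.injective
  let V := isometryOfOrthonormal b hon
  set v := V.toContinuousLinearMap
  have hv : ∀ i, v (b i) = b (σ i) := fun i => isometryOfOrthonormal_apply b hon i
  have hvv : v * v = 1 := ext_hilbertBasis b fun i => by
    rw [mul_apply_eq_comp, hv, hv, hσ]; rfl
  have hsa : IsSelfAdjoint v := by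
    rw [ContinuousLinearMap.isSelfAdjoint_iff_isSymmetric]
    intro x y
    have hy : y = v (v y) := (DFunLike.congr_fun hvv y).symm
    conv_lhs => rw [hy]
    exact V.inner_map_map x (v y)
  have hσ' : ∀ {B : Set ι}, (∀ i, σ i ∈ B ↔ i ∉ B) → ∀ i, σ i ∈ Bᶜ ↔ i ∉ Bᶜ :=
    fun h i => not_congr (h i)
  exact ⟨v, ⟨hsa, hvv, compression_eq_zero hA hσA hv, compression_eq_zero hA.one_sub (hσ' hσA) hv⟩,
    ⟨hsa, hvv, compression_eq_zero hC hσC hv, compression_eq_zero hC.one_sub (hσ' hσC) hv⟩⟩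

/-- Each basis vector lies in one of the two blocks, so removing the off-diagonal blocks leaves the
diagonal alone. -/
theorem diagEntry_blockDiag {b : HilbertBasis ι 𝕜 H} {A : Set ι} {e : H →L[𝕜] H}
    (he : IsStarProjection e) (hA : IsCoordinateProjection b A e) (x : H →L[𝕜] H) (i : ι) :
    diagEntry b (e * x * e + (1 - e) * x * (1 - e)) i = diagEntry b x i := by
  have h : ∀ f : H →L[𝕜] H, IsStarProjection f →
      inner 𝕜 (b i) ((f * x * f) (b i)) = inner 𝕜 (f (b i)) (x (f (b i))) :=
    fun f hf => (inner_isStarProjection hf _ _).symm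
  rw [diagEntry, diagEntry, add_apply, inner_add_right, h e he, h _ he.one_sub]
  by_cases hi : i ∈ A
  · simp [hA.1 i hi]
  · simp [hA.2 i hi]

/-- The self-adjoint unitaries with vanishing diagonal. -/
def zeroDiagSymmetries (b : HilbertBasis ι 𝕜 H) : Set (H →L[𝕜] H) :=
  {x | IsSelfAdjoint x ∧ x * x = 1 ∧ ∀ i, diagEntry b x i = 0}

theorem offDiagSymmetries_subset {b : HilbertBasis ι 𝕜 H} {A : Set ι} {e : H →L[𝕜] H}
    (he : IsStarProjection e) (hA : IsCoordinateProjection b A e) :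
    offDiagSymmetries e ⊆ zeroDiagSymmetries b := fun v hv => ⟨hv.1, hv.2.1, fun i => by
  rw [← diagEntry_blockDiag he hA, hv.2.2.1, hv.2.2.2]
  simp [diagEntry]⟩

/-- Points of the deformation are `t a + z` with `z` off-diagonal. The diagonal of `z` vanishes, and
that of `a` equals that of `x`, which is zero. -/
theorem exists_joinedIn_offDiagSymmetries [Nontrivial H] {b : HilbertBasis ι 𝕜 H} {A : Set ι}
    {e x : H →L[𝕜] H} (he : IsStarProjection e) (hA : IsCoordinateProjection b A e)
    (hx : x ∈ zeroDiagSymmetries b) (h1 : ‖e * x * e‖ < 1)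
    (h2 : ‖(1 - e) * x * (1 - e)‖ < 1) :
    ∃ v ∈ offDiagSymmetries e, JoinedIn (zeroDiagSymmetries b) x v := by
  obtain ⟨v, hv, hj⟩ := exists_path_to_offDiagSymmetries he hx.1 hx.2.1 h1 h2
  refine ⟨v, hv, hj.mono ?_⟩
  rintro y ⟨hy1, hy2, t, z, hz1, hz2, rfl⟩
  refine ⟨hy1, hy2, fun i => ?_⟩
  have hz : diagEntry b z i = 0 := by
    rw [← diagEntry_blockDiag he hA, hz1, hz2]; simp [diagEntry]
  have ha := diagEntry_blockDiag he hA x i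
  rw [hx.2.2] at ha
  rw [diagEntry] at hz ha ⊢
  rw [add_apply, smul_apply, inner_add_right, inner_smul_right, ha, hz, mul_zero, add_zero]

theorem two_smul_sub_one_mem {b : HilbertBasis ι 𝕜 H} {p : H →L[𝕜] H}
    (hp : p ∈ halfProjections b) : (2 : 𝕜) • p - 1 ∈ zeroDiagSymmetries b := by
  classical
  obtain ⟨h1, h2⟩ := hp
  refine ⟨?_, ?_, fun i => ?_⟩
  · simp [IsSelfAdjoint, h1.isSelfAdjoint.star_eq]
  · simp only [sub_mul, mul_sub, smul_mul_smul_comm, h1.isIdempotentElem.eq, one_mul, mul_one]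
    module
  · have h := inner_diagExp b p i i
    have hb : inner 𝕜 (b i) (b i) = (1 : 𝕜) := by
      rw [orthonormal_iff_ite.1 b.orthonormal, if_pos rfl]
    rw [h2, if_pos rfl, smul_apply, one_apply_eq_self, inner_smul_right, hb] at h
    rw [diagEntry, sub_apply, smul_apply, one_apply_eq_self, inner_sub_right,
      inner_smul_right, hb, ← h]
    norm_num

theorem half_smul_one_add_mem {b : HilbertBasis ι 𝕜 H} {x : H →L[𝕜] H}
    (hx : x ∈ zeroDiagSymmetries b) : (1 / 2 : 𝕜) • (1 + x) ∈ halfProjections b := by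
  classical
  obtain ⟨h1, h2, h3⟩ := hx
  refine ⟨⟨?_, ?_⟩, ext_hilbertBasis b fun j => ext_inner_hilbertBasis b fun i => ?_⟩
  · rw [IsIdempotentElem]
    simp only [add_mul, mul_add, smul_mul_smul_comm, h2, one_mul, mul_one]
    module
  · simp [IsSelfAdjoint, h1.star_eq]
  · rw [inner_diagExp]
    simp only [smul_apply, add_apply, one_apply_eq_self, inner_smul_right,
      inner_add_right, orthonormal_iff_ite.1 b.orthonormal]
    split_ifs with h
    · subst h
      rw [show inner 𝕜 (b i) (x (b i)) = 0 from h3 i, add_zero]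
    · simp

end Coordinates

end DiagProj

/-! ### Assembling the path -/

theorem mainTheorem9 {𝕜 H ι : Type*} [RCLike 𝕜] [NormedAddCommGroup H] [InnerProductSpace 𝕜 H]
    [CompleteSpace H] [TopologicalSpace.SeparableSpace H] (hH : ¬ FiniteDimensional 𝕜 H)
    (b : HilbertBasis ι 𝕜 H) (p q : H →L[𝕜] H)
    (hp : p ∈ DiagProj.halfProjections b)
    (hp2 : DiagProj.IsTwoPavable b ((2 : 𝕜) • p - 1))
    (hq : q ∈ DiagProj.halfProjections b)
    (hq2 : DiagProj.IsTwoPavable b ((2 : 𝕜) • q - 1)) :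
    JoinedIn (DiagProj.halfProjections b) p q := by
  open DiagProj in
  have : Countable ι := countable_of_orthonormal b.orthonormal
  have : Nontrivial H := by
    by_contra h
    rw [not_nontrivial_iff_subsingleton] at h
    exact hH inferInstance
  obtain ⟨-, e, he, hed, he1, he2⟩ := hp2
  obtain ⟨-, f, hf, hfd, hf1, hf2⟩ := hq2
  have hA := hed.isCoordinateProjection he
  have hB := hfd.isCoordinateProjection hf
  obtain ⟨v, hv, hpv⟩ := exists_joinedIn_offDiagSymmetries he hA (two_smul_sub_one_mem hp) he1 he2
  obtain ⟨w, hw, hqw⟩ := exists_joinedIn_offDiagSymmetries hf hB (two_smul_sub_one_mem hq) hf1 hf2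
  have hv' := hv
  have hw' := hw
  -- Passing to `1 - e` and `1 - f` makes the complements of both index sets infinite as well.
  rw [← offDiagSymmetries_one_sub] at hv' hw'
  obtain ⟨C, hAC, hBC⟩ := exists_common_splitting
    (infinite_of_mem_offDiagSymmetries hA he.isIdempotentElem.eq hv hH)
    (infinite_of_mem_offDiagSymmetries hA.one_sub he.one_sub.isIdempotentElem.eq hv' hH)
    (infinite_of_mem_offDiagSymmetries hB hf.isIdempotentElem.eq hw hH)
    (infinite_of_mem_offDiagSymmetries hB.one_sub hf.one_sub.isIdempotentElem.eq hw' hH)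
  obtain ⟨g, hg, hgC⟩ := exists_isCoordinateProjection b C
  obtain ⟨s, hse, hsg⟩ := exists_common_offDiagSymmetry hA hgC hAC
  obtain ⟨t, htf, htg⟩ := exists_common_offDiagSymmetry hB hgC hBC
  have h1 := (joinedIn_offDiagSymmetries he hse hv hH).mono (offDiagSymmetries_subset he hA)
  have h2 := (joinedIn_offDiagSymmetries hg htg hsg hH).mono (offDiagSymmetries_subset hg hgC)
  have h3 := (joinedIn_offDiagSymmetries hf hw htf hH).mono (offDiagSymmetries_subset hf hB)
  -- The chain is `2p - 1 → v → s → t → w → 2q - 1`: the inner three legs are off-diagonal for `e`,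
  -- `g` and `f` in turn.
  have h := (((hpv.trans h1).trans h2).trans h3).trans hqw.symm
  have hpath := h.map (f := fun x => (1 / 2 : 𝕜) • (1 + x)) (by fun_prop)
  have hhalf : ∀ r : H →L[𝕜] H, (1 / 2 : 𝕜) • (1 + ((2 : 𝕜) • r - 1)) = r := fun r => by module
  rw [hhalf, hhalf] at hpath
  refine hpath.mono ?_
  rintro _ ⟨x, hx, rfl⟩
  exact half_smul_one_add_mem hx
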